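/- Let $b\ge 2$, $\Lambda=\{0,\dots,b-1\}$, $\Lambda^*=\bigcup_{n\ge 0}\Lambda^n$ the set of finite words, and $\Sigma=\Lambda^{\mathbb Z_+}$ the symbolic space with the product topology, its Borel $\sigma$-field and the left shift $\sigma$. For $x=x_1x_2\cdots\in\Sigma$ write $x|_n=x_1\cdots x_n$, and for $u\in\Lambda^*$ let $[u]$ be the set of elements of $\Sigma$ with prefix $u$. Let $V=(V_0,\dots,V_{b-1})$ be a random vector with $V_j\ge 0$ and $\mathbb E(V_j)=1$ for all $j$ (the coordinates need not be independent), and let $(X_u)_{u\in\Lambda^*\setminus\{\emptyset\}}$ be nonnegative random variables on a probability space $(\Omega,\mathcal A,\mathbb P)$ such that the random vectors $(X_{uj})_{j\in\Lambda}$, $u\in\Lambda^*$, are independent and all distributed as $V$. Put $$Q_n(\omega,x)=\prod_{k=1}^n X_{x|_k}(\omega).$$ Let $\nu$ be a $\sigma$-invariant and ergodic Borel probability measure on $\Sigma$, with entropy $$h_\nu(\sigma)=\lim_{n\to\infty}\frac1n\sum_{u\in\Lambda^n}-\nu([u])\log\nu([u]).$$ Let $\nu_n(\mathrm dx)=Q_n(\cdot,x)\,\nu(\mathrm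 dx)$, let $Z_n$ be the total mass of $\nu_n$ and $Z=\limsup_{n\to\infty}Z_n$, and let $Q\cdot\nu$ be the almost sure weak limit of $\nu_n$ as $n\to\infty$ (which exists). One says that $\nu$ is $Q$-regular if $\mathbb E(\|Q\cdot\nu\|)=\|\nu\|$, where $\|\cdot\|$ is the total mass, and $Q$-singular if $Q\cdot\nu=0$ almost surely. Set $$h_{V,\nu}=\sum_{j\in\Lambda}\mathbb E(V_j\log V_j)\,\nu([j])\in[0,\infty],$$ with $0\log 0=0$ and $\infty\cdot 0=0$. Then: (i) if $h_{V,\nu}<h_\nu(\sigma)$, then $\mathbb E(Z)=1$ and $\nu$ is $Q$-regular; (ii) if $h_{V,\nu}>h_\nu(\sigma)$, then $\mathbb E(Z)=0$ and $\nu$ is $Q$-singular. -/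

import Mathlib

open MeasureTheory ProbabilityTheory Filter
open scoped ENNReal Topology

noncomputable section

namespace Cascade

/-- The one-sided symbolic space over the alphabet `{0, …, b - 1}`. Its topology is the product
of the discrete topologies and its `σ`-algebra is the corresponding Borel `σ`-algebra. The letter
`x_{k+1}` of the text `x = x_1 x_2 …` is `x k` here. -/
abbrev SymbolicSpace (b : ℕ) : Type := ℕ → Fin b

variable {b : ℕ} {Ω Ω' : Type*}

/-- The left shift. -/
def shift (x : SymbolicSpace b) : SymbolicSpace b := fun n => x (n + 1)

/-- The prefix of length `n` of `x`, as a finite word (a list of letters). -/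
def pre (x : SymbolicSpace b) (n : ℕ) : List (Fin b) := List.ofFn fun i : Fin n => x i

/-- The cylinder of all sequences that start with the word `u`. -/
def cyl (u : List (Fin b)) : Set (SymbolicSpace b) := {x | pre x u.length = u}

/-- The Shannon entropy of the partition into cylinders of generation `n`. -/
def blockEntropy (ν : Measure (SymbolicSpace b)) (n : ℕ) : ℝ :=
  ∑ u : Fin n → Fin b,
    -(ν.real (cyl (List.ofFn u)) * Real.log (ν.real (cyl (List.ofFn u))))

/-- The entropy of `ν` with respect to the shift, `lim (1 / n) H_n`. For a shift-invariant
probability measure the limit exists and is a real number in `[0, log b]`; writing it as an upper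
limit in the extended reals makes the definition total. -/
def entropy (ν : Measure (SymbolicSpace b)) : EReal :=
  limsup (fun n : ℕ => ((blockEntropy ν n / n : ℝ) : EReal)) atTop

/-- The expectation, in the extended reals, of a random variable whose negative part has finite
expectation. -/
def extExpectation [MeasurableSpace Ω'] (P' : Measure Ω') (f : Ω' → ℝ) : EReal :=
  ((∫⁻ ω, ENNReal.ofReal (f ω) ∂P' : ℝ≥0∞) : EReal) -
    ((∫⁻ ω, ENNReal.ofReal (-f ω) ∂P' : ℝ≥0∞) : EReal)

/-- `∑ j, E (V_j log V_j) ν([j])`, with `0 log 0 = 0` and `∞ · 0 = 0`. -/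
def weightEntropy [MeasurableSpace Ω'] (P' : Measure Ω') (V : Ω' → Fin b → ℝ)
    (ν : Measure (SymbolicSpace b)) : EReal :=
  ∑ j : Fin b, extExpectation P' (fun ω => V ω j * Real.log (V ω j)) *
    ((ν.real (cyl [j]) : ℝ) : EReal)

/-- `X` is an independent multiplicative cascade with weight vector `V`: the random vectors
`(X_{uj})_j`, for `u` a finite word, are independent copies of `V`, a random vector with
nonnegative entries of expectation `1`. The entries of `V` may depend on one another.
The value of `X` at the empty word plays no role. -/
structure IsIndependentCascade [MeasurableSpace Ω] [MeasurableSpace Ω'] (P : Measure Ω)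
    (X : List (Fin b) → Ω → ℝ) (P' : Measure Ω') (V : Ω' → Fin b → ℝ) : Prop where
  measurable_X : ∀ u j, Measurable (X (u ++ [j]))
  X_nonneg : ∀ u j ω, 0 ≤ X (u ++ [j]) ω
  measurable_V : Measurable V
  V_nonneg : ∀ ω j, 0 ≤ V ω j
  mean_V : ∀ j, ∫ ω, V ω j ∂P' = 1
  indep : iIndepFun (fun (u : List (Fin b)) (ω : Ω) (j : Fin b) => X (u ++ [j]) ω) P
  identDistrib : ∀ u, IdentDistrib (fun ω j => X (u ++ [j]) ω) V P P'

/-- `Q_n(ω, x) = X_{x_1}(ω) X_{x_1 x_2}(ω) ⋯ X_{x_1 ⋯ x_n}(ω)`. -/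
def density (X : List (Fin b) → Ω → ℝ) (n : ℕ) (ω : Ω) (x : SymbolicSpace b) : ℝ :=
  ∏ k ∈ Finset.range n, X (pre x (k + 1)) ω

lemma exists_density_le (X : List (Fin b) → Ω → ℝ) (n : ℕ) (ω : Ω) :
    ∃ C : ℝ, ∀ x, density X n ω x ≤ C := by
  have h : ∀ k : ℕ, ∃ c : ℝ, ∀ x : SymbolicSpace b, |X (pre x k) ω| ≤ c := by
    intro k
    obtain ⟨c, hc⟩ := (Set.finite_range
      (fun u : Fin k → Fin b => |X (List.ofFn u) ω|)).bddAbove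
    exact ⟨c, fun x => hc ⟨fun i => x i, rfl⟩⟩
  choose c hc using h
  refine ⟨∏ k ∈ Finset.range n, c (k + 1), fun x => (le_abs_self _).trans ?_⟩
  rw [density, Finset.abs_prod]
  exact Finset.prod_le_prod (fun _ _ => abs_nonneg _) fun k _ => hc (k + 1) x

instance isFiniteMeasure_density (X : List (Fin b) → Ω → ℝ) (ν : Measure (SymbolicSpace b))
    [IsFiniteMeasure ν] (n : ℕ) (ω : Ω) :
    IsFiniteMeasure (ν.withDensity fun x => ENNReal.ofReal (density X n ω x)) := by
  obtain ⟨C, hC⟩ := exists_density_le X n ω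
  refine isFiniteMeasure_withDensity (ne_of_lt ?_)
  calc ∫⁻ x, ENNReal.ofReal (density X n ω x) ∂ν ≤ ∫⁻ _, ENNReal.ofReal C ∂ν :=
        lintegral_mono fun x => ENNReal.ofReal_le_ofReal (hC x)
    _ < ∞ := by
        rw [lintegral_const]
        exact ENNReal.mul_lt_top ENNReal.ofReal_lt_top (measure_lt_top ν _)

/-- The random measure `ν_n = Q_n · ν`. -/
def approx (X : List (Fin b) → Ω → ℝ) (ν : Measure (SymbolicSpace b)) [IsFiniteMeasure ν]
    (n : ℕ) (ω : Ω) : FiniteMeasure (SymbolicSpace b) :=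
  ⟨ν.withDensity fun x => ENNReal.ofReal (density X n ω x), inferInstance⟩

/-- `Z = limsup Z_n`, where `Z_n` is the total mass of `ν_n`. -/
def limitMass (X : List (Fin b) → Ω → ℝ) (ν : Measure (SymbolicSpace b)) [IsFiniteMeasure ν]
    (ω : Ω) : ℝ≥0∞ :=
  limsup (fun n => (approx X ν n ω : Measure (SymbolicSpace b)) Set.univ) atTop

/-- `M` is (a version of) the random measure `Q · ν`, the almost sure weak limit of `ν_n`. -/
def IsActionLimit [MeasurableSpace Ω] (P : Measure Ω) (X : List (Fin b) → Ω → ℝ)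
    (ν : Measure (SymbolicSpace b)) [IsFiniteMeasure ν]
    (M : Ω → FiniteMeasure (SymbolicSpace b)) : Prop :=
  ∀ᵐ ω ∂P, Tendsto (fun n => approx X ν n ω) atTop (𝓝 (M ω))

/-- `ν` is `Q`-regular: `Q · ν` exists and the mass of `E (Q · ν)` is that of `ν`. -/
def IsQRegular [MeasurableSpace Ω] (P : Measure Ω) (X : List (Fin b) → Ω → ℝ)
    (ν : Measure (SymbolicSpace b)) [IsFiniteMeasure ν] : Prop :=
  ∃ M : Ω → FiniteMeasure (SymbolicSpace b), IsActionLimit P X ν M ∧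
    ∫⁻ ω, (M ω : Measure (SymbolicSpace b)) Set.univ ∂P = ν Set.univ

/-- `ν` is `Q`-singular: `Q · ν` exists and vanishes almost surely. -/
def IsQSingular [MeasurableSpace Ω] (P : Measure Ω) (X : List (Fin b) → Ω → ℝ)
    (ν : Measure (SymbolicSpace b)) [IsFiniteMeasure ν] : Prop :=
  ∃ M : Ω → FiniteMeasure (SymbolicSpace b), IsActionLimit P X ν M ∧ ∀ᵐ ω ∂P, M ω = 0

end Cascade

end

/-! The measure `Q_n(ω, x) ν(dx) P(dω)` is a probability measure on pairs. Under it, given a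
`ν`-typical branch `x` (the spine), the weights along `x` are independent, the `k`-th having the
size-biased law of `V_j` with `j` the `k`-th letter of `x`. Its mean logarithm is `E (V_j log V_j)`.
Letters have frequencies `ν [j]` by ergodicity, so the law of large numbers gives `Q_n(x) ≈ exp (n
h_V)`, while Shannon–McMillan–Breiman gives `ν [x|n] ≈ exp (-n h)`. The sign of `h_V - h` decides
whether the cylinder around the spine carries a huge or a negligible mass `Q_n(x) ν [x|n]`.

If `h_V > h`, then `Z_n ≥ Q_n(x) ν [x|n]` is large with high probability under the tilted law, that
is, `E (Z_n; Z_n < R) → 0` for every `R` (`lintegral_indicator_cylMass_le`). As `Z_n` converges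
almost surely to a finite limit, Fatou's lemma forces `Z = 0`.

If `h_V < a < a' < h`, keep only the pairs with `Q_m(x) ≤ C exp (a m)` for `m ≤ n` and `ν [x|m] ≤ C
exp (-a' m)` for all `m`. Two branches separating at generation `m` contribute at most a constant
times `exp (a m)` to the second moment of the truncated mass (`lintegral_truncDensity_mul_le`), and
integrating over the second branch gives a geometric series of ratio `exp (a - a')`. The truncated
masses are thus bounded in `L²`, so no mass escapes in the limit. By the spine law the truncation
loses arbitrarily little mean as `C` grows, whence `E Z = 1`.

The entropy estimates come from the backward conditional probabilities `g(x)` of the first letter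
given the others. The mean of `-log g` is the entropy, and `ν [x|n] / ∏ g(σ^k x)` has mean at most
one (`lintegral_cyl_mul_gInv_le`). With the ergodic theorem this gives the almost sure exponential
upper bound on cylinders. The opposite bound, needed only in measure, follows from it and from the
convergence of the means.

Each cylinder mass `ν_n [u]` is a nonnegative martingale. Its convergence for all words `u` at once
yields the weak limit `Q · ν`, whose total mass is `Z`. -/

noncomputable section

/-! ### Birkhoff sums over an ergodic transformation -/

section Birkhoff

variable {α : Type*}

/-- The running maximum `max (0, S_1 f, …, S_n f)` of the Birkhoff sums. -/
def birkhoffMax (T : α → α) (f : α → ℝ) : ℕ → α → ℝ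
  | 0 => fun _ => 0
  | n + 1 => fun x => max 0 (f x + birkhoffMax T f n (T x))

lemma birkhoffMax_nonneg (T : α → α) (f : α → ℝ) (n : ℕ) (x : α) : 0 ≤ birkhoffMax T f n x := by
  cases n with
  | zero => exact le_rfl
  | succ n => exact le_max_left _ _

lemma birkhoffMax_le_succ (T : α → α) (f : α → ℝ) (n : ℕ) (x : α) :
    birkhoffMax T f n x ≤ birkhoffMax T f (n + 1) x := by
  induction n generalizing x with
  | zero => exact birkhoffMax_nonneg T f 1 x
  | succ n ih => exact max_le_max le_rfl (by gcongr; exact ih (T x))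

lemma birkhoffSum_le_birkhoffMax (T : α → α) (f : α → ℝ) (n : ℕ) (x : α) :
    birkhoffSum T f n x ≤ birkhoffMax T f n x := by
  induction n generalizing x with
  | zero => simp [birkhoffMax]
  | succ n ih =>
    rw [birkhoffSum_succ']
    exact le_max_of_le_right (by gcongr; exact ih (T x))

variable [MeasurableSpace α] {μ : Measure α} {T : α → α} {f : α → ℝ}

lemma measurable_birkhoffMax (hT : Measurable T) (hf : Measurable f) (n : ℕ) :
    Measurable (birkhoffMax T f n) := by
  induction n with
  | zero => exact measurable_const
  | succ n ih => exact measurable_const.max (hf.add (ih.comp hT))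

lemma integrable_birkhoffMax [IsFiniteMeasure μ] (hT : MeasurePreserving T μ μ)
    (hi : Integrable f μ) (n : ℕ) : Integrable (birkhoffMax T f n) μ := by
  induction n with
  | zero => exact integrable_const 0
  | succ n ih => exact (integrable_const 0).sup (hi.add (hT.integrable_comp_of_integrable ih))

/-- Birkhoff sums of a function of negative mean are bounded above almost everywhere. -/
theorem Ergodic.ae_bddAbove_birkhoffSum [IsFiniteMeasure μ] (hT : Ergodic T μ)
    (hf : Measurable f) (hi : Integrable f μ) (hneg : ∫ x, f x ∂μ < 0) :
    ∀ᵐ x ∂μ, BddAbove (Set.range fun n => birkhoffSum T f n x) := by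
  set R := birkhoffMax T f
  set A : Set α := {x | ∀ K : ℕ, ∃ n, (K : ℝ) < R n x}
  have hRm : ∀ n, Measurable (R n) := measurable_birkhoffMax hT.measurable hf
  have hA : MeasurableSet A := by
    simp only [A, Set.ofPred_forall, Set.ofPred_exists]
    exact MeasurableSet.iInter fun K => MeasurableSet.iUnion fun n =>
      measurableSet_lt measurable_const (hRm n)
  -- By the recursion, the running maxima at `x` and at `T x` differ by an amount controlled by the
  -- fixed number `|f x|`, so they are unbounded together.
  have hinv : T ⁻¹' A = A := by
    ext x
    constructor
    · intro h K
      obtain ⟨L, hL⟩ := exists_nat_gt ((K : ℝ) + |f x|)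
      obtain ⟨n, hn⟩ := h L
      refine ⟨n + 1, lt_max_of_lt_right ?_⟩
      have := neg_abs_le (f x)
      linarith
    · intro h K
      obtain ⟨L, hL⟩ := exists_nat_gt ((K : ℝ) + |f x|)
      obtain ⟨n, hn⟩ := h L
      refine ⟨n, ?_⟩
      have h1 := hn.trans_le (birkhoffMax_le_succ T f n x)
      rcases lt_max_iff.1 h1 with h2 | h2
      · have : (0 : ℝ) ≤ L := Nat.cast_nonneg L
        linarith
      · have := le_abs_self (f x)
        linarith
  rcases hT.toPreErgodic.ae_mem_or_ae_notMem hA hinv with h | h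
  · exfalso
    -- If the maxima diverge almost everywhere, then `max (-R n (T x)) (f x)` is eventually `f x`.
    -- But this function equals `R (n + 1) x - R n (T x)`, whose integral is nonnegative because `T`
    -- preserves `μ` and `R` increases with `n`. This contradicts the negative mean of `f`.
    have hlim : Tendsto (fun n => ∫ x, max (-R n (T x)) (f x) ∂μ) atTop (𝓝 (∫ x, f x ∂μ)) := by
      refine tendsto_integral_of_dominated_convergence (fun x => |f x|)
        (fun n => (((hRm n).comp hT.measurable).neg.max hf).aestronglyMeasurable) hi.abs
        (fun n => ae_of_all _ fun x => ?_) ?_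
      · rw [Real.norm_eq_abs, abs_le]
        refine ⟨(neg_abs_le _).trans (le_max_right _ _), max_le ?_ (le_abs_self _)⟩
        have := birkhoffMax_nonneg T f n (T x)
        have := abs_nonneg (f x)
        linarith
      · filter_upwards [h] with x hx
        obtain ⟨L, hL⟩ := exists_nat_gt |f x|
        obtain ⟨n, hn⟩ := (hinv.symm ▸ hx : x ∈ T ⁻¹' A) L
        refine tendsto_const_nhds.congr' ?_
        filter_upwards [eventually_ge_atTop n] with m hm
        have h1 : R n (T x) ≤ R m (T x) :=
          monotone_nat_of_le_succ (f := fun n => R n (T x))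
            (fun k => birkhoffMax_le_succ T f k (T x)) hm
        have := neg_abs_le (f x)
        exact (max_eq_right (by linarith)).symm
    refine absurd (ge_of_tendsto' hlim fun n => ?_) (not_le.2 hneg)
    have hcomp : Integrable (fun x => R n (T x)) μ :=
      hT.toMeasurePreserving.integrable_comp_of_integrable (integrable_birkhoffMax hT.1 hi n)
    have h1 : ∀ x, max (-R n (T x)) (f x) = R (n + 1) x - R n (T x) := by
      intro x
      change _ = max 0 (f x + R n (T x)) - R n (T x)
      rcases le_total 0 (f x + R n (T x)) with h0 | h0
      · rw [max_eq_right h0, max_eq_right (by linarith)]; ring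
      · rw [max_eq_left h0, max_eq_left (by linarith)]; ring
    have h2 : ∫ x, R n (T x) ∂μ = ∫ x, R n x ∂μ := by
      rw [← integral_map hT.measurable.aemeasurable (hRm n).aestronglyMeasurable, hT.map_eq]
    simp_rw [h1]
    rw [integral_sub (integrable_birkhoffMax hT.1 hi _) hcomp, h2, sub_nonneg]
    exact integral_mono (integrable_birkhoffMax hT.1 hi n) (integrable_birkhoffMax hT.1 hi _)
      fun x => birkhoffMax_le_succ T f n x
  · filter_upwards [h] with x hx
    simp only [A, Set.mem_ofPred_eq, not_forall, not_exists, not_lt] at hx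
    obtain ⟨K, hK⟩ := hx
    exact ⟨K, by rintro _ ⟨n, rfl⟩; exact (birkhoffSum_le_birkhoffMax T f n x).trans (hK n)⟩

/-- Half of the pointwise ergodic theorem. -/
lemma Ergodic.ae_eventually_birkhoffSum_le [IsProbabilityMeasure μ] (hT : Ergodic T μ)
    (hf : Measurable f) (hi : Integrable f μ) {c : ℝ} (hc : ∫ x, f x ∂μ < c) :
    ∀ᵐ x ∂μ, ∀ᶠ n : ℕ in atTop, birkhoffSum T f n x ≤ c * n := by
  obtain ⟨c', h1, h2⟩ := exists_between hc
  have := hT.ae_bddAbove_birkhoffSum (f := fun x => f x - c') (hf.sub_const _)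
    (hi.sub (integrable_const _)) (by
      rw [integral_sub hi (integrable_const _)]; simpa using h1)
  filter_upwards [this] with x ⟨K, hK⟩
  have h3 : ∀ᶠ n : ℕ in atTop, K ≤ (c - c') * n :=
    (tendsto_natCast_atTop_atTop.const_mul_atTop (sub_pos.2 h2)).eventually_ge_atTop K
  filter_upwards [h3] with n hn
  have h4 := hK ⟨n, rfl⟩
  simp only [birkhoffSum, Finset.sum_sub_distrib, Finset.sum_const, Finset.card_range,
    nsmul_eq_mul] at h4 ⊢
  linarith

/-- The pointwise ergodic theorem for an ergodic transformation. -/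
theorem Ergodic.ae_tendsto_birkhoffSum_div [IsProbabilityMeasure μ] (hT : Ergodic T μ)
    (hf : Measurable f) (hi : Integrable f μ) :
    ∀ᵐ x ∂μ, Tendsto (fun n : ℕ => birkhoffSum T f n x / n) atTop (𝓝 (∫ x, f x ∂μ)) := by
  have h1 : ∀ k : ℕ, ∀ᵐ x ∂μ, ∀ᶠ n : ℕ in atTop,
      birkhoffSum T f n x ≤ (∫ x, f x ∂μ + 1 / (k + 1)) * n := fun k =>
    hT.ae_eventually_birkhoffSum_le hf hi (by have : (0 : ℝ) < 1 / (k + 1) := by positivity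
                                              linarith)
  have h2 : ∀ k : ℕ, ∀ᵐ x ∂μ, ∀ᶠ n : ℕ in atTop,
      birkhoffSum T (fun x => -f x) n x ≤ (-∫ x, f x ∂μ + 1 / (k + 1)) * n := fun k =>
    hT.ae_eventually_birkhoffSum_le hf.neg hi.neg (by
      have : (0 : ℝ) < 1 / (k + 1) := by positivity
      rw [integral_neg']; linarith)
  filter_upwards [ae_all_iff.2 h1, ae_all_iff.2 h2] with x h1 h2
  rw [Metric.tendsto_atTop']
  intro ε hε
  obtain ⟨k, hk⟩ := exists_nat_one_div_lt hε
  obtain ⟨N, hN⟩ := eventually_atTop.1 ((h1 k).and ((h2 k).and (eventually_gt_atTop 0)))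
  refine ⟨N, fun n hn => ?_⟩
  obtain ⟨h3, h4, h5⟩ := hN n hn.le
  have h6 : (0 : ℝ) < n := Nat.cast_pos.2 h5
  have h7 : birkhoffSum T (fun x => -f x) n x = -birkhoffSum T f n x := by
    simp [birkhoffSum]
  rw [h7] at h4
  rw [Real.dist_eq, abs_sub_lt_iff, sub_lt_iff_lt_add, div_lt_iff₀ h6, sub_lt_comm, lt_div_iff₀ h6]
  constructor <;> nlinarith

end Birkhoff

namespace Cascade

variable {b : ℕ}

/-! ### Prefixes and cylinders -/

lemma measurable_shift : Measurable (shift : SymbolicSpace b → SymbolicSpace b) :=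
  measurable_pi_lambda _ fun n => measurable_pi_apply (n + 1)

lemma shift_iterate_apply (k n : ℕ) (x : SymbolicSpace b) : (shift^[k] x) n = x (n + k) := by
  induction k generalizing x with
  | zero => rfl
  | succ k ih => rw [Function.iterate_succ_apply, ih]; rfl

@[simp] lemma length_pre (x : SymbolicSpace b) (n : ℕ) : (pre x n).length = n := by simp [pre]

lemma pre_succ (x : SymbolicSpace b) (n : ℕ) : pre x (n + 1) = pre x n ++ [x n] := by
  rw [pre, List.ofFn_succ']
  simp [pre]

lemma pre_succ' (x : SymbolicSpace b) (n : ℕ) : pre x (n + 1) = x 0 :: pre (shift x) n := by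
  simp [pre, List.ofFn_succ, shift]

lemma pre_eq_iff {x y : SymbolicSpace b} {n : ℕ} : pre x n = pre y n ↔ ∀ i < n, x i = y i := by
  rw [pre, pre, List.ofFn_inj, funext_iff]
  exact ⟨fun h i hi => h ⟨i, hi⟩, fun h i => h i i.2⟩

lemma mem_cyl_pre {x y : SymbolicSpace b} {n : ℕ} : x ∈ cyl (pre y n) ↔ pre x n = pre y n := by
  simp [cyl]

lemma mem_cyl_cons {x : SymbolicSpace b} {j : Fin b} {u : List (Fin b)} :
    x ∈ cyl (j :: u) ↔ x 0 = j ∧ shift x ∈ cyl u := by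
  simp [cyl, pre_succ']

lemma mem_cyl_ofFn {x : SymbolicSpace b} {n : ℕ} {u : Fin n → Fin b} :
    x ∈ cyl (List.ofFn u) ↔ (fun i : Fin n => x i) = u := by
  have h : ∀ m (h : m = n), pre x m = List.ofFn u ↔ (fun i : Fin n => x i) = u := by
    rintro m rfl
    exact List.ofFn_inj
  exact h _ (List.length_ofFn ..)

lemma cyl_ofFn {n : ℕ} (u : Fin n → Fin b) :
    cyl (List.ofFn u) = (fun (x : SymbolicSpace b) (i : Fin n) => x i) ⁻¹' {u} := by
  ext x; exact mem_cyl_ofFn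

lemma measurable_restrictFin (n : ℕ) :
    Measurable fun (x : SymbolicSpace b) (i : Fin n) => x i := by fun_prop

lemma measurableSet_cyl (u : List (Fin b)) : MeasurableSet (cyl u) := by
  rw [← List.ofFn_get u, cyl_ofFn]
  exact measurable_restrictFin _ (measurableSet_singleton _)

lemma measurable_comp_pre {β : Type*} [MeasurableSpace β] (n : ℕ) (F : List (Fin b) → β) :
    Measurable fun x : SymbolicSpace b => F (pre x n) :=
  (measurable_of_countable fun u : Fin n → Fin b => F (List.ofFn u)).comp
    (measurable_restrictFin n)

lemma integral_comp_pre (ν : Measure (SymbolicSpace b)) [IsFiniteMeasure ν] (n : ℕ)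
    (F : List (Fin b) → ℝ) :
    ∫ x, F (pre x n) ∂ν = ∑ u : Fin n → Fin b, ν.real (cyl (List.ofFn u)) * F (List.ofFn u) := by
  have h := integral_map (μ := ν) (measurable_restrictFin (b := b) n).aemeasurable
    (f := fun u => F (List.ofFn u)) (measurable_of_countable _).aestronglyMeasurable
  change _ = ∫ x, F (pre x n) ∂ν at h
  rw [← h, integral_fintype (.of_finite)]
  refine Finset.sum_congr rfl fun u _ => ?_
  rw [smul_eq_mul, cyl_ofFn, map_measureReal_apply (measurable_restrictFin n)
    (measurableSet_singleton _)]

lemma integrable_comp_pre (ν : Measure (SymbolicSpace b)) [IsFiniteMeasure ν] (n : ℕ)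
    (F : List (Fin b) → ℝ) : Integrable (fun x => F (pre x n)) ν :=
  (Integrable.of_finite (μ := ν.map _) (f := fun u : Fin n → Fin b => F (List.ofFn u))).comp_measurable
    (measurable_restrictFin n)

lemma measurableSet_letter (j : Fin b) : MeasurableSet {x : SymbolicSpace b | x 0 = j} :=
  measurableSet_eq_fun (measurable_pi_apply 0) measurable_const

lemma cyl_cons (j : Fin b) (u : List (Fin b)) :
    cyl (j :: u) = shift ⁻¹' cyl u ∩ {x | x 0 = j} := by
  ext x; rw [mem_cyl_cons, and_comm]; rfl

lemma cyl_singleton (j : Fin b) : cyl [j] = {x | x 0 = j} := by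
  ext x; rw [mem_cyl_cons]; simp [cyl, pre]

lemma ae_cyl_ne_zero (ν : Measure (SymbolicSpace b)) :
    ∀ᵐ x ∂ν, ∀ n, ν (cyl (pre x n)) ≠ 0 := by
  rw [ae_all_iff]
  intro n
  rw [ae_iff]
  refine measure_mono_null (t := ⋃ u ∈ {u : Fin n → Fin b | ν (cyl (List.ofFn u)) = 0},
    cyl (List.ofFn u)) (fun x hx => ?_) ?_
  · simp only [ne_eq, not_not, Set.mem_ofPred_eq] at hx
    exact Set.mem_biUnion (x := fun i : Fin n => x i) hx (mem_cyl_pre.2 rfl)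
  · exact (measure_biUnion_null_iff (Set.to_countable _)).2 fun u hu => hu

/-! ### The backward conditional probabilities of an invariant measure -/

variable (ν : Measure (SymbolicSpace b))

/-- The image under the shift of the restriction of `ν` to the cylinder `[j]`. -/
def branch (j : Fin b) : Measure (SymbolicSpace b) := (ν.restrict {x | x 0 = j}).map shift

/-- The conditional probability that the first letter is `j` given the shifted sequence. -/
def backProb (j : Fin b) : SymbolicSpace b → ℝ≥0∞ := (branch ν j).rnDeriv ν

/-- The conditional probability of the first letter given the remaining ones. -/
def gFun (x : SymbolicSpace b) : ℝ≥0∞ := backProb ν (x 0) (shift x)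

/-- The entropy as the mean entropy of the first letter given the remaining ones. -/
def condEntropy : ℝ := ∫ y, ∑ j, Real.negMulLog (backProb ν j y).toReal ∂ν

lemma measurable_backProb (j : Fin b) : Measurable (backProb ν j) := Measure.measurable_rnDeriv _ _

lemma measurable_gFun : Measurable (gFun ν) :=
  (measurable_from_prod_countable_right (f := fun p : Fin b × SymbolicSpace b => backProb ν p.1 p.2)
    fun j => measurable_backProb ν j).comp ((measurable_pi_apply 0).prodMk measurable_shift)

lemma branch_cyl (j : Fin b) (u : List (Fin b)) : branch ν j (cyl u) = ν (cyl (j :: u)) := by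
  rw [branch, Measure.map_apply measurable_shift (measurableSet_cyl u),
    Measure.restrict_apply (measurable_shift (measurableSet_cyl u)), cyl_cons]

instance [IsFiniteMeasure ν] (j : Fin b) : IsFiniteMeasure (branch ν j) := by
  unfold branch; infer_instance

instance [IsFiniteMeasure ν] (j : Fin b) : (branch ν j).HaveLebesgueDecomposition ν :=
  haveI : SFinite (branch ν j) := inferInstance
  Measure.haveLebesgueDecomposition_of_sigmaFinite _ _

lemma sum_branch : ∑ j, branch ν j = ν.map shift := by
  ext s hs
  have h : ∀ j, branch ν j s = ν.restrict (shift ⁻¹' s) ((fun x => x 0) ⁻¹' {j}) := fun j => by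
    rw [branch, Measure.map_apply measurable_shift hs, Measure.restrict_apply (measurable_shift hs),
      Measure.restrict_apply (measurable_pi_apply 0 (measurableSet_singleton j)), Set.inter_comm]
    rfl
  rw [Measure.map_apply measurable_shift hs, Measure.finsetSum_apply]
  simp_rw [h]
  refine (sum_measure_preimage_singleton (f := fun x : SymbolicSpace b => x 0) _ fun j _ =>
    measurable_pi_apply 0 (measurableSet_singleton j)).trans ?_
  simp

variable {ν}

/-- Invariance enters here: it makes each branch absolutely continuous with density at most one, so
that `backProb` is a true conditional probability. -/
lemma branch_le (hν : MeasurePreserving shift ν ν) (j : Fin b) : branch ν j ≤ ν := by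
  calc branch ν j ≤ ν.map shift := Measure.map_mono Measure.restrict_le_self measurable_shift
    _ = ν := hν.map_eq

lemma sum_cyl_cons (hν : MeasurePreserving shift ν ν) (u : List (Fin b)) :
    ∑ j, ν (cyl (j :: u)) = ν (cyl u) := by
  simp_rw [← branch_cyl, ← Measure.finsetSum_apply, sum_branch, hν.map_eq]

lemma lintegral_mul_backProb [IsProbabilityMeasure ν] (hν : MeasurePreserving shift ν ν) (j : Fin b)
    {F : SymbolicSpace b → ℝ≥0∞} (hF : Measurable F) :
    ∫⁻ x in {x | x 0 = j}, F (shift x) ∂ν = ∫⁻ y, backProb ν j y * F y ∂ν := by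
  rw [← lintegral_map hF measurable_shift]
  exact (lintegral_rnDeriv_mul (branch_le hν j).absolutelyContinuous hF.aemeasurable).symm

lemma backProb_le_one [IsProbabilityMeasure ν] (hν : MeasurePreserving shift ν ν) : ∀ᵐ y ∂ν, ∀ j, backProb ν j y ≤ 1 :=
  ae_all_iff.2 fun j => Measure.rnDeriv_le_one_of_le (branch_le hν j)

lemma lintegral_comp_shift [IsProbabilityMeasure ν] (hν : MeasurePreserving shift ν ν)
    {F : Fin b → SymbolicSpace b → ℝ≥0∞} (hF : ∀ j, Measurable (F j)) :
    ∫⁻ x, F (x 0) (shift x) ∂ν = ∑ j, ∫⁻ y, backProb ν j y * F j y ∂ν := by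
  simp_rw [← lintegral_mul_backProb hν _ (hF _)]
  have h : ∀ x : SymbolicSpace b, F (x 0) (shift x)
      = ∑ j, ({x : SymbolicSpace b | x 0 = j}.indicator (fun x => F j (shift x)) x) := by
    intro x
    rw [Finset.sum_eq_single (x 0)]
    · simp
    · intro j _ hj; simp [hj.symm]
    · simp
  simp_rw [h]
  have hm : ∀ j, Measurable fun x => {x : SymbolicSpace b | x 0 = j}.indicator
      (fun x => F j (shift x)) x := fun j =>
    ((hF j).comp measurable_shift).indicator (measurableSet_letter j)
  rw [lintegral_finsetSum _ fun j _ => hm j]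
  simp_rw [lintegral_indicator (measurableSet_letter _)]

lemma gFun_le_one [IsProbabilityMeasure ν] (hν : MeasurePreserving shift ν ν) : ∀ᵐ x ∂ν, gFun ν x ≤ 1 := by
  filter_upwards [hν.quasiMeasurePreserving.ae (backProb_le_one hν)] with x hx using hx _

/-- The event that the first letter is `j` and `backProb ν j` vanishes at the shifted point has
measure equal to the integral of `backProb ν j` over its own zero set. -/
lemma gFun_ne_zero [IsProbabilityMeasure ν] (hν : MeasurePreserving shift ν ν) : ∀ᵐ x ∂ν, gFun ν x ≠ 0 := by
  have h := lintegral_comp_shift hν (F := fun j y => {y | backProb ν j y = 0}.indicator 1 y)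
    fun j => measurable_one.indicator (measurable_backProb ν j (measurableSet_singleton 0))
  rw [Finset.sum_eq_zero] at h
  · rw [lintegral_eq_zero_iff] at h
    · filter_upwards [h] with x hx h0
      simp [Set.indicator, show backProb ν (x 0) (shift x) = 0 from h0] at hx
    · exact (measurable_from_prod_countable_right
        (f := fun p : Fin b × SymbolicSpace b => {y | backProb ν p.1 y = 0}.indicator 1 p.2)
        fun j => measurable_one.indicator (measurable_backProb ν j (measurableSet_singleton 0))).comp
          ((measurable_pi_apply 0).prodMk measurable_shift)
  · intro j _
    refine (lintegral_congr fun y => ?_).trans lintegral_zero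
    by_cases hy : backProb ν j y = 0 <;> simp [hy]

/-- The reciprocal of the conditional probability of the first `n` letters given the others. -/
def gInv (ν : Measure (SymbolicSpace b)) (n : ℕ) (x : SymbolicSpace b) : ℝ≥0∞ :=
  ∏ k ∈ Finset.range n, (gFun ν (shift^[k] x))⁻¹

lemma gInv_succ (n : ℕ) (x : SymbolicSpace b) :
    gInv ν (n + 1) x = gInv ν n (shift x) * (gFun ν x)⁻¹ := by
  rw [gInv, Finset.prod_range_succ']; rfl

lemma measurable_gInv (n : ℕ) : Measurable (gInv ν n) :=
  Finset.measurable_prod _ fun k _ => ((measurable_gFun ν).comp (measurable_shift.iterate k)).inv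

/-- Conditioning on the shifted sequence, the first letter has weight `backProb`, which cancels the
newest factor of `gInv`. Summing over that letter turns the cylinders `[ju]` into `[u]`, which is
the induction step. The cancellation is only an inequality because `backProb` may vanish. -/
lemma lintegral_cyl_mul_gInv_le [IsProbabilityMeasure ν] (hν : MeasurePreserving shift ν ν) (n : ℕ) :
    ∫⁻ x, ν (cyl (pre x n)) * gInv ν n x ∂ν ≤ 1 := by
  induction n with
  | zero => simpa [gInv] using lintegral_mono (μ := ν) fun x => prob_le_one (μ := ν) (s := cyl (pre x 0))
  | succ n ih =>
    refine le_trans ?_ ih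
    have hm : ∀ j : Fin b, Measurable fun y : SymbolicSpace b => ν (cyl (j :: pre y n)) :=
      fun j => measurable_comp_pre n fun u => ν (cyl (j :: u))
    calc ∫⁻ x, ν (cyl (pre x (n + 1))) * gInv ν (n + 1) x ∂ν
        = ∑ j, ∫⁻ y, backProb ν j y *
            (ν (cyl (j :: pre y n)) * (gInv ν n y * (backProb ν j y)⁻¹)) ∂ν := by
          rw [← lintegral_comp_shift hν (F := fun j y =>
            ν (cyl (j :: pre y n)) * (gInv ν n y * (backProb ν j y)⁻¹)) fun j =>
              (hm j).mul ((measurable_gInv n).mul (measurable_backProb ν j).inv)]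
          simp_rw [gInv_succ, pre_succ']
          rfl
      _ ≤ ∑ j, ∫⁻ y, ν (cyl (j :: pre y n)) * gInv ν n y ∂ν := by
          refine Finset.sum_le_sum fun j _ => lintegral_mono fun y => ?_
          calc backProb ν j y * (ν (cyl (j :: pre y n)) * (gInv ν n y * (backProb ν j y)⁻¹)) = (ν (cyl (j :: pre y n)) * gInv ν n y) *
                (backProb ν j y * (backProb ν j y)⁻¹) := by ring
            _ ≤ (ν (cyl (j :: pre y n)) * gInv ν n y) * 1 := by
                gcongr; exact ENNReal.mul_inv_le_one _
            _ = _ := mul_one _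
      _ = ∫⁻ x, ν (cyl (pre x n)) * gInv ν n x ∂ν := by
          have hm' : ∀ j : Fin b, Measurable fun y => ν (cyl (j :: pre y n)) * gInv ν n y :=
            fun j => (hm j).mul (measurable_gInv n)
          rw [← lintegral_finsetSum _ fun j _ => hm' j]
          simp_rw [← Finset.sum_mul, sum_cyl_cons hν]

end Cascade

namespace Cascade

variable {b : ℕ} {ν : Measure (SymbolicSpace b)}

/-! ### The entropy of an invariant measure -/

/-- The `σ`-algebra of the first `n` letters. -/
def letterFiltration (b : ℕ) :
    Filtration ℕ (MeasurableSpace.pi : MeasurableSpace (SymbolicSpace b)) where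
  seq n := MeasurableSpace.comap (fun x (i : Fin n) => x i) inferInstance
  mono' m n hmn := by
    rw [MeasurableSpace.comap_le_iff_le_map]
    intro s hs
    refine ⟨(fun (u : Fin n → Fin b) (i : Fin m) => u (Fin.castLE hmn i)) ⁻¹' s, ?_, rfl⟩
    exact Set.toFinite _ |>.measurableSet
  le' n := (measurable_restrictFin n).comap_le

lemma iSup_letterFiltration : ⨆ n, letterFiltration b n = MeasurableSpace.pi := by
  refine le_antisymm (iSup_le fun n => (letterFiltration b).le n) ?_
  refine iSup_le fun k => ?_
  refine le_trans ?_ (le_iSup _ (k + 1))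
  rw [MeasurableSpace.comap_le_iff_le_map]
  intro s hs
  exact ⟨(fun u : Fin (k + 1) → Fin b => u (Fin.last k)) ⁻¹' s,
    (Set.toFinite _).measurableSet, rfl⟩

/-- The conditional probability of the first letter given the `n` following ones. -/
def blockProb (ν : Measure (SymbolicSpace b)) (j : Fin b) (u : List (Fin b)) : ℝ :=
  ν.real (cyl (j :: u)) / ν.real (cyl u)

section

variable [IsProbabilityMeasure ν]

lemma sum_real_cyl_cons (hν : MeasurePreserving shift ν ν) (u : List (Fin b)) :
    ∑ j, ν.real (cyl (j :: u)) = ν.real (cyl u) := by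
  simp_rw [measureReal_def, ← sum_cyl_cons hν u]
  rw [ENNReal.toReal_sum fun j _ => measure_ne_top _ _]

lemma real_cyl_cons_le (hν : MeasurePreserving shift ν ν) (j : Fin b) (u : List (Fin b)) :
    ν.real (cyl (j :: u)) ≤ ν.real (cyl u) := by
  rw [← sum_real_cyl_cons hν u]
  exact Finset.single_le_sum (f := fun j => ν.real (cyl (j :: u)))
    (fun _ _ => measureReal_nonneg) (Finset.mem_univ j)

omit [IsProbabilityMeasure ν] in
lemma blockProb_nonneg (j : Fin b) (u : List (Fin b)) : 0 ≤ blockProb ν j u := by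
  unfold blockProb; positivity

lemma blockProb_le_one (hν : MeasurePreserving shift ν ν) (j : Fin b) (u : List (Fin b)) :
    blockProb ν j u ≤ 1 := div_le_one_of_le₀ (real_cyl_cons_le hν j u) measureReal_nonneg

lemma real_cyl_mul_blockProb (hν : MeasurePreserving shift ν ν) (j : Fin b) (u : List (Fin b)) :
    ν.real (cyl u) * blockProb ν j u = ν.real (cyl (j :: u)) := by
  rcases eq_or_ne (ν.real (cyl u)) 0 with h | h
  · have := real_cyl_cons_le hν j u
    rw [h, zero_mul]
    exact le_antisymm measureReal_nonneg (this.trans h.le)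
  · rw [blockProb, mul_div_cancel₀ _ h]

lemma integrable_backProb (j : Fin b) :
    Integrable (fun y => (backProb ν j y).toReal) ν := Measure.integrable_toReal_rnDeriv

/-- On a cylinder `[u]` of length `n`, both functions have integral `ν [ju]`: one by the definition
of the density, the other because it is constant there. -/
lemma condExp_backProb (hν : MeasurePreserving shift ν ν) (j : Fin b) (n : ℕ) :
    (fun y => blockProb ν j (pre y n)) =ᵐ[ν]
      ν[fun y => (backProb ν j y).toReal | letterFiltration b n] := by
  refine ae_eq_condExp_of_forall_setIntegral_eq ((letterFiltration b).le n)
    (integrable_backProb j) (fun s _ _ => (integrable_comp_pre ν n _).integrableOn) ?_ ?_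
  · rintro _ ⟨B, hB, rfl⟩ -
    set s := (fun (x : SymbolicSpace b) (i : Fin n) => x i) ⁻¹' B
    have hs : MeasurableSet s := measurable_restrictFin n hB
    have h1 : ∫ y in s, (backProb ν j y).toReal ∂ν = (branch ν j).real s :=
      Measure.setIntegral_toReal_rnDeriv (branch_le hν j).absolutelyContinuous s
    have h2 : ∀ μ : Measure (SymbolicSpace b), ∀ G : List (Fin b) → ℝ, IsFiniteMeasure μ →
        ∫ y in s, G (pre y n) ∂μ = ∑ u : Fin n → Fin b,
          μ.real (cyl (List.ofFn u)) * (B.indicator 1 u * G (List.ofFn u)) := by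
      intro μ G _
      classical
      -- The integrand must be a function of a list; the length test recovers the word in `Fin n →
      -- Fin b`, and its default value `0` is never used on prefixes of length `n`.
      have h3 := integral_comp_pre μ n fun l =>
        (if h : l.length = n then B.indicator 1 (fun i => l.get (Fin.cast h.symm i)) else 0) * G l
      simp only [length_pre, List.length_ofFn, dite_true] at h3
      rw [← integral_indicator hs]
      convert h3 using 3 with x u
      · by_cases hx : x ∈ s
        · rw [Set.indicator_of_mem hx, Set.indicator_of_mem, Pi.one_apply, one_mul]
          simp only [pre, List.get_ofFn]
          exact hx
        · rw [Set.indicator_of_notMem hx, Set.indicator_of_notMem, zero_mul]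
          simp only [pre, List.get_ofFn]
          exact hx
      · congr 2; simp
    have h4 := h2 (branch ν j) (fun _ => 1) inferInstance
    simp only [integral_const, smul_eq_mul, mul_one, measureReal_restrict_apply_univ] at h4
    rw [h1, h4, h2 ν (blockProb ν j) inferInstance]
    refine Finset.sum_congr rfl fun u _ => ?_
    rw [mul_left_comm, real_cyl_mul_blockProb hν, mul_comm, measureReal_def, measureReal_def,
      branch_cyl]
  · have : Measurable[letterFiltration b n] fun y : SymbolicSpace b => blockProb ν j (pre y n) :=
      (measurable_of_countable fun u : Fin n → Fin b => blockProb ν j (List.ofFn u)).comp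
        (comap_measurable _)
    exact this.stronglyMeasurable.aestronglyMeasurable

/-- Lévy's upward theorem: the letter filtration generates the whole Borel `σ`-algebra. -/
lemma tendsto_blockProb (hν : MeasurePreserving shift ν ν) (j : Fin b) :
    ∀ᵐ y ∂ν, Tendsto (fun n => blockProb ν j (pre y n)) atTop (𝓝 (backProb ν j y).toReal) := by
  have h := (integrable_backProb j).tendsto_ae_condExp (ℱ := letterFiltration b) (by
    rw [iSup_letterFiltration]
    exact (measurable_backProb ν j).ennreal_toReal.stronglyMeasurable)
  filter_upwards [h, ae_all_iff.2 fun n => condExp_backProb hν j n] with y h1 h2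
  exact h1.congr fun n => (h2 n).symm

lemma negMulLog_le_one {t : ℝ} (h0 : 0 ≤ t) : Real.negMulLog t ≤ 1 := by
  linarith [Real.negMulLog_le_one_sub_self h0]

lemma tendsto_integral_blockProb (hν : MeasurePreserving shift ν ν) :
    Tendsto (fun n => ∫ y, ∑ j, Real.negMulLog (blockProb ν j (pre y n)) ∂ν) atTop
      (𝓝 (condEntropy ν)) := by
  refine tendsto_integral_of_dominated_convergence (fun _ => ∑ _j : Fin b, (1 : ℝ))
    (fun n => (integrable_comp_pre ν n fun u =>
      ∑ j, Real.negMulLog (blockProb ν j u)).aestronglyMeasurable)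
    (integrable_const _) (fun n => ae_of_all _ fun y => ?_) ?_
  · rw [Real.norm_of_nonneg (Finset.sum_nonneg fun j _ =>
      Real.negMulLog_nonneg (blockProb_nonneg _ _) (blockProb_le_one hν _ _))]
    exact Finset.sum_le_sum fun j _ => negMulLog_le_one (blockProb_nonneg _ _)
  · filter_upwards [ae_all_iff.2 fun j => tendsto_blockProb hν j] with y hy
    exact tendsto_finsetSum _ fun j _ => (Real.continuous_negMulLog.tendsto _).comp (hy j)

/-- The chain rule for entropy, with the new letter added on the left so that the conditioning on
the following letters becomes finer as `n` grows. -/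
lemma blockEntropy_succ (hν : MeasurePreserving shift ν ν) (n : ℕ) :
    blockEntropy ν (n + 1) =
      blockEntropy ν n + ∫ y, ∑ j, Real.negMulLog (blockProb ν j (pre y n)) ∂ν := by
  rw [integral_comp_pre ν n fun u => ∑ j, Real.negMulLog (blockProb ν j u), blockEntropy,
    blockEntropy, ← Finset.sum_add_distrib,
    ← (Fin.consEquiv fun _ : Fin (n + 1) => Fin b).sum_comp, Fintype.sum_prod_type,
    Finset.sum_comm]
  refine Finset.sum_congr rfl fun u _ => ?_
  have h : ∀ j : Fin b, -(ν.real (cyl (j :: List.ofFn u)) *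
      Real.log (ν.real (cyl (j :: List.ofFn u)))) =
      blockProb ν j (List.ofFn u) * Real.negMulLog (ν.real (cyl (List.ofFn u))) +
        ν.real (cyl (List.ofFn u)) * Real.negMulLog (blockProb ν j (List.ofFn u)) := by
    intro j
    rw [← Real.negMulLog_mul, real_cyl_mul_blockProb hν, Real.negMulLog_eq_neg]
  simp only [Fin.consEquiv_apply, List.ofFn_succ, Fin.cons_zero, Fin.cons_succ]
  simp_rw [h]
  rw [Finset.sum_add_distrib, ← Finset.sum_mul, ← Finset.mul_sum]
  congr 1
  rw [Real.negMulLog_eq_neg]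
  rcases eq_or_ne (ν.real (cyl (List.ofFn u))) 0 with h0 | h0
  · simp [h0]
  · simp only [blockProb]
    rw [← Finset.sum_div, sum_real_cyl_cons hν, div_self h0, one_mul]

lemma blockEntropy_eq_sum (hν : MeasurePreserving shift ν ν) (n : ℕ) :
    blockEntropy ν n =
      ∑ k ∈ Finset.range n, ∫ y, ∑ j, Real.negMulLog (blockProb ν j (pre y k)) ∂ν := by
  induction n with
  | zero => simp [blockEntropy, cyl, pre]
  | succ n ih => rw [Finset.sum_range_succ, ← ih, blockEntropy_succ hν]

/-- The block entropy is a sum of conditional entropies that converge to `condEntropy ν`; Cesàro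
averaging does the rest. -/
lemma tendsto_blockEntropy (hν : MeasurePreserving shift ν ν) :
    Tendsto (fun n : ℕ => blockEntropy ν n / n) atTop (𝓝 (condEntropy ν)) := by
  refine (tendsto_integral_blockProb hν).cesaro.congr fun n => ?_
  rw [blockEntropy_eq_sum hν, div_eq_inv_mul]

theorem entropy_eq (hν : MeasurePreserving shift ν ν) :
    entropy ν = ((condEntropy ν : ℝ) : EReal) :=
  ((continuous_coe_real_ereal.tendsto _).comp (tendsto_blockEntropy hν)).limsup_eq

/-! ### Exponential decay of the measure of cylinders -/

/-- The truncated information function. -/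
def truncInfo (ν : Measure (SymbolicSpace b)) (K : ℝ) (x : SymbolicSpace b) : ℝ :=
  min (-Real.log (gFun ν x).toReal) K

omit [IsProbabilityMeasure ν] in
lemma measurable_truncInfo (K : ℝ) : Measurable (truncInfo ν K) :=
  (Real.measurable_log.comp (measurable_gFun ν).ennreal_toReal).neg.min measurable_const

lemma truncInfo_nonneg (hν : MeasurePreserving shift ν ν) {K : ℝ} (hK : 0 ≤ K) :
    ∀ᵐ x ∂ν, 0 ≤ truncInfo ν K x := by
  filter_upwards [gFun_le_one hν] with x hx
  refine le_min (neg_nonneg.2 (Real.log_nonpos ENNReal.toReal_nonneg ?_)) hK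
  exact ENNReal.toReal_le_of_le_ofReal zero_le_one (by simpa using hx)

lemma integrable_truncInfo (hν : MeasurePreserving shift ν ν) {K : ℝ} (hK : 0 ≤ K) :
    Integrable (truncInfo ν K) ν := by
  refine .of_bound (measurable_truncInfo K).aestronglyMeasurable K ?_
  filter_upwards [truncInfo_nonneg hν hK] with x hx
  rw [Real.norm_of_nonneg hx]
  exact min_le_right _ _

/-- Splitting by the first letter and pushing forward by the shift turns each piece into an integral
against a branch, that is, against the density `backProb ν j`. Truncation keeps the information
function bounded, and a lower bound on its Birkhoff sums is all that is needed later. -/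
lemma integral_truncInfo (hν : MeasurePreserving shift ν ν) {K : ℝ} (hK : 0 ≤ K) :
    ∫ x, truncInfo ν K x ∂ν = ∑ j, ∫ y, (backProb ν j y).toReal *
      min (-Real.log (backProb ν j y).toReal) K ∂ν := by
  have hU : (⋃ j : Fin b, {x : SymbolicSpace b | x 0 = j}) = Set.univ := by ext; simp
  rw [← setIntegral_univ, ← hU, integral_iUnion_fintype (fun j => measurableSet_letter j) ?_
    fun j => (integrable_truncInfo hν hK).integrableOn]
  · refine Finset.sum_congr rfl fun j _ => ?_
    have hm : Measurable fun y => min (-Real.log (backProb ν j y).toReal) K :=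
      (Real.measurable_log.comp (measurable_backProb ν j).ennreal_toReal).neg.min measurable_const
    have h1 : ∫ x in {x | x 0 = j}, truncInfo ν K x ∂ν =
        ∫ x in {x | x 0 = j}, min (-Real.log (backProb ν j (shift x)).toReal) K ∂ν :=
      setIntegral_congr_fun (measurableSet_letter j) fun x hx => by
        simp only [truncInfo, gFun, show x 0 = j from hx]
    rw [h1, ← integral_map (φ := shift) measurable_shift.aemeasurable hm.aestronglyMeasurable]
    exact (integral_toReal_rnDeriv_mul (branch_le hν j).absolutelyContinuous).symm
  · intro i j hij
    exact Set.disjoint_left.2 fun x hi hj => hij (hi.symm.trans hj)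

lemma tendsto_integral_truncInfo (hν : MeasurePreserving shift ν ν) :
    Tendsto (fun K : ℕ => ∫ x, truncInfo ν K x ∂ν) atTop (𝓝 (condEntropy ν)) := by
  have hq : ∀ᵐ y ∂ν, ∀ j, (backProb ν j y).toReal ≤ 1 := by
    filter_upwards [backProb_le_one hν] with y hy j
    exact ENNReal.toReal_le_of_le_ofReal zero_le_one (by simpa using hy j)
  have hm : ∀ j, Measurable fun y => (backProb ν j y).toReal := fun j =>
    (measurable_backProb ν j).ennreal_toReal
  have hi : ∀ j, Integrable (fun y => Real.negMulLog (backProb ν j y).toReal) ν := fun j => by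
    refine .of_bound (Real.continuous_negMulLog.measurable.comp (hm j)).aestronglyMeasurable 1 ?_
    filter_upwards [hq] with y hy
    rw [Real.norm_of_nonneg (Real.negMulLog_nonneg ENNReal.toReal_nonneg (hy j))]
    exact negMulLog_le_one ENNReal.toReal_nonneg
  rw [condEntropy, integral_finsetSum _ fun j _ => hi j]
  simp_rw [fun K : ℕ => integral_truncInfo hν (Nat.cast_nonneg (α := ℝ) K)]
  refine tendsto_finsetSum _ fun j _ => ?_
  refine tendsto_integral_of_dominated_convergence
    (fun y => Real.negMulLog (backProb ν j y).toReal)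
    (fun K => ((hm j).mul ((Real.measurable_log.comp (hm j)).neg.min
      measurable_const)).aestronglyMeasurable) (hi j) (fun K => ?_) ?_
  · filter_upwards [hq] with y hy
    have h0 : 0 ≤ (backProb ν j y).toReal := ENNReal.toReal_nonneg
    have h1 := Real.log_nonpos h0 (hy j)
    rw [Real.norm_of_nonneg (mul_nonneg h0 (le_min (by linarith) K.cast_nonneg)),
      Real.negMulLog_eq_neg]
    refine le_of_le_of_eq ?_ (mul_neg _ _)
    exact mul_le_mul_of_nonneg_left (min_le_left _ _) h0
  · refine ae_of_all _ fun y => tendsto_const_nhds.congr' ?_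
    obtain ⟨L, hL⟩ := exists_nat_ge (-Real.log (backProb ν j y).toReal)
    filter_upwards [eventually_ge_atTop L] with K hK
    rw [min_eq_left (hL.trans (Nat.cast_le.2 hK)), Real.negMulLog_eq_neg]
    exact (mul_neg _ _).symm

/-- The lower half of the Shannon–McMillan–Breiman theorem. -/
theorem ae_exists_cyl_le (hν : Ergodic shift ν) {a : ℝ} (ha : a < condEntropy ν) :
    ∀ᵐ x ∂ν, ∃ C : ℝ, ∀ n : ℕ, ν.real (cyl (pre x n)) ≤ C * Real.exp (-(a * n)) := by
  have hmp := hν.toMeasurePreserving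
  obtain ⟨a', ha1, ha2⟩ := exists_between ha
  obtain ⟨K, hK⟩ := ((tendsto_integral_truncInfo hmp).eventually (lt_mem_nhds ha2)).exists
  have hK0 : (0 : ℝ) ≤ K := K.cast_nonneg
  -- The mean of `a' - truncInfo` is negative, so its Birkhoff sums stay below some `M`; hence `gInv
  -- ν n x ≥ exp (a' n - M)`.
  have hbd := hν.ae_bddAbove_birkhoffSum (f := fun x => a' - truncInfo ν K x)
    (measurable_const.sub (measurable_truncInfo _))
    ((integrable_const _).sub (integrable_truncInfo hmp hK0)) (by
      rw [integral_sub (integrable_const _) (integrable_truncInfo hmp hK0)]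
      simpa using hK)
  set r : ℝ := Real.exp (-(a' - a))
  have hr0 : 0 ≤ r := (Real.exp_pos _).le
  have hr1 : r < 1 := by rw [← Real.exp_zero]; exact Real.exp_lt_exp.2 (by linarith)
  have hmeas : ∀ n, Measurable fun x => ν (cyl (pre x n)) * gInv ν n x := fun n =>
    (measurable_comp_pre n fun u => ν (cyl u)).mul (measurable_gInv n)
  -- The `n`-th term has mean at most `r ^ n`, so the series converges almost everywhere and each
  -- term is at most its sum `B`. The loss `r ^ (-n)` is exactly the gap between the rates `a'` and
  -- `a`.
  have hsum : ∀ᵐ x ∂ν, ∑' n, ν (cyl (pre x n)) * gInv ν n x * ENNReal.ofReal r ^ n < ∞ := by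
    refine ae_lt_top (Measurable.tsum fun n => (hmeas n).mul_const _) (ne_of_lt ?_)
    rw [lintegral_tsum fun n => ((hmeas n).mul_const _).aemeasurable]
    calc ∑' n, ∫⁻ x, ν (cyl (pre x n)) * gInv ν n x * ENNReal.ofReal r ^ n ∂ν
        ≤ ∑' n, ENNReal.ofReal r ^ n := by
          refine ENNReal.tsum_le_tsum fun n => ?_
          rw [lintegral_mul_const _ (hmeas n)]
          exact mul_le_of_le_one_left' (lintegral_cyl_mul_gInv_le hmp n)
      _ < ∞ := by
          rw [ENNReal.tsum_geometric, ENNReal.inv_lt_top, tsub_pos_iff_lt]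
          simpa using hr1
  have hg : ∀ᵐ x ∂ν, ∀ k, gFun ν (shift^[k] x) ≠ 0 ∧ gFun ν (shift^[k] x) ≤ 1 := by
    rw [ae_all_iff]
    intro k
    exact (hmp.iterate k).quasiMeasurePreserving.ae ((gFun_ne_zero hmp).and (gFun_le_one hmp))
  filter_upwards [hbd, hsum, hg] with x ⟨M, hM⟩ hx hg
  set B := ∑' n, ν (cyl (pre x n)) * gInv ν n x * ENNReal.ofReal r ^ n
  refine ⟨B.toReal * Real.exp M, fun n => ?_⟩
  have h1 : ENNReal.ofReal (Real.exp (a' * n - M)) ≤ gInv ν n x := by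
    calc ENNReal.ofReal (Real.exp (a' * n - M))
        ≤ ENNReal.ofReal (Real.exp (∑ k ∈ Finset.range n, truncInfo ν K (shift^[k] x))) := by
          gcongr
          have := hM ⟨n, rfl⟩
          simp only [birkhoffSum, Finset.sum_sub_distrib, Finset.sum_const, Finset.card_range,
            nsmul_eq_mul] at this
          linarith
      _ = ∏ k ∈ Finset.range n, ENNReal.ofReal (Real.exp (truncInfo ν K (shift^[k] x))) := by
          rw [Real.exp_sum, ENNReal.ofReal_prod_of_nonneg fun _ _ => (Real.exp_pos _).le]
      _ ≤ gInv ν n x := by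
          refine Finset.prod_le_prod' fun k _ => ?_
          have h2 : gFun ν (shift^[k] x) ≠ ∞ := ne_top_of_le_ne_top ENNReal.one_ne_top (hg k).2
          have h3 := ENNReal.toReal_pos (hg k).1 h2
          calc ENNReal.ofReal (Real.exp (truncInfo ν K (shift^[k] x)))
              ≤ ENNReal.ofReal (Real.exp (-Real.log (gFun ν (shift^[k] x)).toReal)) := by
                gcongr; exact min_le_left _ _
            _ = (gFun ν (shift^[k] x))⁻¹ := by
                rw [Real.exp_neg, Real.exp_log h3, ENNReal.ofReal_inv_of_pos h3,
                  ENNReal.ofReal_toReal h2]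
  have h2 : ν (cyl (pre x n)) * ENNReal.ofReal (Real.exp (a' * n - M)) * ENNReal.ofReal r ^ n ≤ B :=
    le_trans (by gcongr) (ENNReal.le_tsum n)
  have h3 := ENNReal.toReal_mono hx.ne h2
  rw [ENNReal.toReal_mul, ENNReal.toReal_mul, ENNReal.toReal_pow, ENNReal.toReal_ofReal hr0,
    ENNReal.toReal_ofReal (Real.exp_pos _).le, ← measureReal_def, ← Real.exp_nat_mul, mul_assoc,
    ← Real.exp_add] at h3
  have h4 : a' * n - M + n * -(a' - a) = a * n - M := by ring
  rw [h4] at h3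
  calc ν.real (cyl (pre x n))
      = ν.real (cyl (pre x n)) * Real.exp (a * n - M) * (Real.exp M * Real.exp (-(a * n))) := by
        rw [mul_assoc, ← Real.exp_add, ← Real.exp_add]; ring_nf; simp
    _ ≤ B.toReal * (Real.exp M * Real.exp (-(a * n))) := by gcongr
    _ = _ := by ring

/-- The upper half of the Shannon–McMillan theorem (convergence in measure). -/
theorem tendsto_measure_cyl_lt (hν : Ergodic shift ν) {a : ℝ} (ha : condEntropy ν < a) :
    Tendsto (fun n : ℕ => ν {x | ν.real (cyl (pre x n)) < Real.exp (-(a * n))}) atTop (𝓝 0) := by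
  have hmp := hν.toMeasurePreserving
  set c := condEntropy ν
  set f : ℕ → SymbolicSpace b → ℝ := fun n x => -Real.log (ν.real (cyl (pre x n))) / n
  have hfi : ∀ n, Integrable (f n) ν := fun n =>
    integrable_comp_pre ν n fun u => -Real.log (ν.real (cyl u)) / n
  have hf0 : ∀ n x, 0 ≤ f n x := fun n x =>
    div_nonneg (neg_nonneg.2 (Real.log_nonpos measureReal_nonneg measureReal_le_one)) n.cast_nonneg
  have hfint : ∀ n, ∫ x, f n x ∂ν = blockEntropy ν n / n := fun n => by
    rw [integral_comp_pre ν n fun u => -Real.log (ν.real (cyl u)) / n, blockEntropy,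
      Finset.sum_div]
    refine Finset.sum_congr rfl fun u _ => by ring
  -- The almost sure lower bound `liminf f n ≥ c`, with `c - f n ≤ c`, gives convergence of the
  -- negative part of `f n - c` in mean.
  have hlow : Tendsto (fun n => ∫ x, max (c - f n x) 0 ∂ν) atTop (𝓝 0) := by
    have h0 : Tendsto (fun n => ∫ x, max (c - f n x) 0 ∂ν) atTop
        (𝓝 (∫ _x : SymbolicSpace b, (0 : ℝ) ∂ν)) := ?_
    · rwa [integral_zero] at h0
    refine tendsto_integral_of_dominated_convergence (fun _ => max c 0)
      (fun n => (((integrable_const c).sub (hfi n)).sup (integrable_const 0)).aestronglyMeasurable)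
      (integrable_const _) (fun n => ae_of_all _ fun x => ?_) ?_
    · rw [Real.norm_of_nonneg (le_max_right _ _)]
      exact max_le_max (by linarith [hf0 n x]) le_rfl
    · have hk : ∀ k : ℕ, ∀ᵐ x ∂ν, ∃ C : ℝ, ∀ n : ℕ,
          ν.real (cyl (pre x n)) ≤ C * Real.exp (-((c - 1 / (k + 1)) * n)) := fun k =>
        ae_exists_cyl_le hν (by have : (0 : ℝ) < 1 / (k + 1) := by positivity
                                linarith)
      filter_upwards [ae_all_iff.2 hk, ae_cyl_ne_zero ν] with x hx hpos
      rw [Metric.tendsto_atTop']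
      intro ε hε
      obtain ⟨k, hk⟩ := exists_nat_one_div_lt (half_pos hε)
      obtain ⟨C, hC⟩ := hx k
      have hp : ∀ n, 0 < ν.real (cyl (pre x n)) := fun n =>
        ENNReal.toReal_pos (hpos n) (measure_ne_top _ _)
      have hC0 : 0 < C := pos_of_mul_pos_left ((hp 0).trans_le (hC 0)) (Real.exp_pos _).le
      obtain ⟨N, hN⟩ := eventually_atTop.1 ((tendsto_natCast_atTop_atTop.const_mul_atTop
        (half_pos hε)).eventually_gt_atTop (Real.log C))
      refine ⟨N, fun n hn => ?_⟩
      have h1 := Real.log_le_log (hp n) (hC n)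
      rw [Real.log_mul hC0.ne' (Real.exp_pos _).ne', Real.log_exp] at h1
      have h2 := hN n hn.le
      have hn0 : (0 : ℝ) < n := Nat.cast_pos.2 (by omega)
      have h3 : c - ε < f n x := by
        rw [lt_div_iff₀ hn0]
        nlinarith
      rw [Real.dist_eq, sub_zero, abs_of_nonneg (le_max_right _ _)]
      exact max_lt (by linarith) hε
  -- As in Scheffé's lemma, the mean of `f n - c` tends to zero, so its positive part vanishes in
  -- mean along with its negative part. Markov's inequality then concludes.
  have hup : Tendsto (fun n => ∫ x, max (f n x - c) 0 ∂ν) atTop (𝓝 0) := by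
    have h1 : ∀ n, ∫ x, max (f n x - c) 0 ∂ν =
        (blockEntropy ν n / n - c) + ∫ x, max (c - f n x) 0 ∂ν := fun n => by
      have h2 : ∀ x, max (f n x - c) 0 = (f n x - c) + max (c - f n x) 0 := fun x => by
        rcases le_total (f n x) c with h | h
        · rw [max_eq_right (by linarith), max_eq_left (by linarith)]; ring
        · rw [max_eq_left (by linarith), max_eq_right (by linarith)]; ring
      simp_rw [h2]
      have h3 : Integrable (fun x => f n x - c) ν := (hfi n).sub (integrable_const c)
      have h4 : Integrable (fun x => max (c - f n x) 0) ν :=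
        ((integrable_const c).sub (hfi n)).sup (integrable_const 0)
      rw [integral_add h3 h4, integral_sub (hfi n) (integrable_const c), hfint]
      simp
    simp_rw [h1]
    simpa [c] using ((tendsto_blockEntropy hmp).sub_const c).add hlow
  have hac : 0 < a - c := sub_pos.2 ha
  have hbound : ∀ᶠ n : ℕ in atTop, ν {x | ν.real (cyl (pre x n)) < Real.exp (-(a * n))} ≤
      ENNReal.ofReal ((a - c)⁻¹ * ∫ x, max (f n x - c) 0 ∂ν) := by
    filter_upwards [eventually_gt_atTop 0] with n hn
    have hn0 : (0 : ℝ) < n := Nat.cast_pos.2 hn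
    have h1 : ν {x | ν.real (cyl (pre x n)) < Real.exp (-(a * n))} ≤
        ν {x | a - c ≤ max (f n x - c) 0} := by
      refine measure_mono_ae ?_
      filter_upwards [ae_cyl_ne_zero ν] with x hpos hx
      have hp : 0 < ν.real (cyl (pre x n)) := ENNReal.toReal_pos (hpos n) (measure_ne_top _ _)
      have h2 := Real.log_lt_log hp hx
      rw [Real.log_exp] at h2
      refine le_max_of_le_left (sub_le_sub_right ?_ c)
      rw [le_div_iff₀ hn0]
      linarith
    have h2 := mul_meas_ge_le_integral_of_nonneg (μ := ν) (f := fun x => max (f n x - c) 0)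
      (ae_of_all _ fun x => le_max_right _ _)
      (((hfi n).sub (integrable_const c)).sup (integrable_const 0)) (a - c)
    refine h1.trans ?_
    rw [← ofReal_measureReal]
    refine ENNReal.ofReal_le_ofReal ?_
    rw [inv_mul_eq_div, le_div_iff₀ hac, mul_comm]
    exact h2
  refine tendsto_of_tendsto_of_tendsto_of_le_of_le' tendsto_const_nhds ?_
    (Eventually.of_forall fun _ => zero_le) hbound
  have := ENNReal.tendsto_ofReal (hup.const_mul (a - c)⁻¹)
  simpa using this

end

end Cascade

namespace Cascade

variable {b : ℕ} {ν : Measure (SymbolicSpace b)} {Ω Ω' : Type*}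

/-! ### Letter frequencies and a strong law along a sequence of letters -/

/-- Every letter has a frequency in `x`, given by `p`, and letters of frequency `0` are absent. -/
structure HasLetterFreq (x : SymbolicSpace b) (p : Fin b → ℝ) : Prop where
  tendsto : ∀ j, Tendsto (fun n : ℕ => (Nat.count (fun k => x k = j) n : ℝ) / n) atTop (𝓝 (p j))
  absent : ∀ j, p j = 0 → ∀ k, x k ≠ j
  nonneg : ∀ j, 0 ≤ p j

/-- Frequencies come from the ergodic theorem for indicators of one-letter cylinders. A letter of
measure zero is absent because countably many shift preimages of a null cylinder are null. -/
lemma ae_hasLetterFreq [IsProbabilityMeasure ν] (hν : Ergodic shift ν) :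
    ∀ᵐ x ∂ν, HasLetterFreq x fun j => ν.real (cyl [j]) := by
  have h1 : ∀ j : Fin b, ∀ᵐ x ∂ν, Tendsto (fun n : ℕ => (Nat.count (fun k => x k = j) n : ℝ) / n)
      atTop (𝓝 (ν.real (cyl [j]))) := by
    intro j
    have hm : Measurable ((cyl [j]).indicator (1 : SymbolicSpace b → ℝ)) :=
      measurable_one.indicator (measurableSet_cyl _)
    have h := hν.ae_tendsto_birkhoffSum_div hm
      ((integrable_const (1 : ℝ)).indicator (measurableSet_cyl [j]))
    filter_upwards [h] with x hx
    rw [integral_indicator_one (measurableSet_cyl _)] at hx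
    refine hx.congr fun n => ?_
    congr 1
    rw [birkhoffSum, Nat.count_eq_card_filter_range, Finset.natCast_card_filter]
    refine Finset.sum_congr rfl fun k _ => ?_
    have : shift^[k] x ∈ cyl [j] ↔ x k = j := by
      rw [cyl_singleton, Set.mem_ofPred_eq, shift_iterate_apply, zero_add]
    simp only [Set.indicator, this, Pi.one_apply]
  have h2 : ∀ j : Fin b, ∀ᵐ x ∂ν, ν.real (cyl [j]) = 0 → ∀ k, x k ≠ j := by
    intro j
    by_cases hj : ν.real (cyl [j]) = 0
    · have h3 : ∀ᵐ x ∂ν, x ∉ cyl [j] := by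
        rw [ae_iff]; simpa [measureReal_eq_zero_iff] using hj
      filter_upwards [ae_all_iff.2 fun k =>
        (hν.toMeasurePreserving.iterate k).quasiMeasurePreserving.ae h3] with x hx _ k
      have := hx k
      rwa [cyl_singleton, Set.mem_ofPred_eq, shift_iterate_apply, zero_add] at this
    · exact ae_of_all _ fun x h => absurd h hj
  filter_upwards [ae_all_iff.2 h1, ae_all_iff.2 h2] with x h1 h2
  exact ⟨h1, h2, fun _ => measureReal_nonneg⟩

lemma HasLetterFreq.tendsto_count {x : SymbolicSpace b} {p : Fin b → ℝ} (hx : HasLetterFreq x p)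
    {j : Fin b} (hj : p j ≠ 0) : Tendsto (Nat.count fun k => x k = j) atTop atTop := by
  have hp : 0 < p j := (hx.nonneg j).lt_of_ne' hj
  have h := (hx.tendsto j).pos_mul_atTop hp tendsto_natCast_atTop_atTop
  refine tendsto_natCast_atTop_iff (R := ℝ).1 (h.congr' ?_)
  filter_upwards [eventually_gt_atTop 0] with n hn
  rw [div_mul_cancel₀ _ (Nat.cast_pos.2 hn).ne']

lemma sum_filter_eq_sum_count (q : ℕ → Prop) [DecidablePred q] (F : ℕ → ℝ) (n : ℕ) :
    ∑ l ∈ Finset.range n with q l, F l = ∑ i ∈ Finset.range (Nat.count q n), F (Nat.nth q i) := by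
  induction n with
  | zero => simp
  | succ n ih =>
    rw [Finset.range_add_one, Finset.filter_insert, Nat.count_succ]
    split_ifs with h
    · rw [Finset.sum_insert (by simp), ih, Finset.sum_range_succ, Nat.nth_count h, add_comm]
    · rw [ih, add_zero]

/-- A strong law of large numbers for independent variables whose distributions follow the letters
of a sequence with letter frequencies. -/
theorem HasLetterFreq.strong_law {x : SymbolicSpace b} {p : Fin b → ℝ} (hx : HasLetterFreq x p)
    (μ : Fin b → Measure ℝ) [∀ j, IsProbabilityMeasure (μ j)] {f : Fin b → ℝ → ℝ}
    (hf : ∀ j, Measurable (f j)) (hi : ∀ j, p j ≠ 0 → Integrable (f j) (μ j)) :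
    ∀ᵐ y ∂(Measure.infinitePi fun l => μ (x l)),
      Tendsto (fun n : ℕ => (∑ l ∈ Finset.range n, f (x l) (y l)) / n) atTop
        (𝓝 (∑ j, p j * ∫ t, f j t ∂μ j)) := by
  -- The coordinates at the successive occurrences of `j` are independent with the common law `μ j`,
  -- so the classical strong law applies along them.
  have key : ∀ j, p j ≠ 0 → ∀ᵐ y ∂(Measure.infinitePi fun l => μ (x l)),
      Tendsto (fun n : ℕ => (∑ i ∈ Finset.range n, f j (y (Nat.nth (fun k => x k = j) i))) / n)
        atTop (𝓝 (∫ t, f j t ∂μ j)) := by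
    intro j hj
    have hinf : (Set.ofPred fun k => x k = j).Infinite := by
      intro hfin
      obtain ⟨n, hn⟩ := ((hx.tendsto_count hj).eventually_gt_atTop hfin.toFinset.card).exists
      exact absurd hn (not_lt.2 (Nat.count_le_card hfin n))
    have hτ : ∀ i, x (Nat.nth (fun k => x k = j) i) = j := Nat.nth_mem_of_infinite hinf
    have hlaw : ∀ i, (Measure.infinitePi fun l => μ (x l)).map
        (fun y => y (Nat.nth (fun k => x k = j) i)) = μ j := by
      intro i
      have := Measure.infinitePi_map_eval (fun l => μ (x l)) (Nat.nth (fun k => x k = j) i)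
      rw [hτ] at this
      exact this
    have hev : ∀ i : ℕ, Measurable fun y : ℕ → ℝ => y i := measurable_pi_apply
    have hident : ∀ i, IdentDistrib (fun y : ℕ → ℝ => f j (y (Nat.nth (fun k => x k = j) i))) (f j)
        (Measure.infinitePi fun l => μ (x l)) (μ j) := fun i =>
      { aemeasurable_fst := ((hf j).comp (hev _)).aemeasurable
        aemeasurable_snd := (hf j).aemeasurable
        map_eq := by rw [← hlaw i, Measure.map_map (hf j) (hev _)]; rfl }
    have hind := (iIndepFun_infinitePi (P := fun l => μ (x l)) (X := fun l t => f j t)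
      fun _ => hf j).precomp (Nat.nth_injective hinf)
    have := strong_law_ae_real (fun i (y : ℕ → ℝ) => f j (y (Nat.nth (fun k => x k = j) i)))
      ((hident 0).integrable_iff.2 (hi j hj)) (fun i k hik => hind.indepFun hik)
      (fun i => (hident i).trans (hident 0).symm)
    rwa [(hident 0).integral_eq] at this
  have key' : ∀ᵐ y ∂(Measure.infinitePi fun l => μ (x l)), ∀ j, p j ≠ 0 →
      Tendsto (fun n : ℕ => (∑ i ∈ Finset.range n, f j (y (Nat.nth (fun k => x k = j) i))) / n)
        atTop (𝓝 (∫ t, f j t ∂μ j)) := by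
    rw [ae_all_iff]
    intro j
    by_cases hj : p j = 0
    · exact ae_of_all _ fun y h => absurd hj h
    · filter_upwards [key j hj] with y hy _ using hy
  filter_upwards [key'] with y hy
  have hsplit : ∀ n, (∑ l ∈ Finset.range n, f (x l) (y l)) / (n : ℝ) =
      ∑ j, (∑ l ∈ Finset.range n with x l = j, f j (y l)) / n := fun n => by
    rw [← Finset.sum_div, ← Finset.sum_fiberwise_of_maps_to (fun l _ => Finset.mem_univ (x l))]
    congr 1
    refine Finset.sum_congr rfl fun j _ => Finset.sum_congr rfl fun l hl => ?_
    rw [(Finset.mem_filter.1 hl).2]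
  simp_rw [hsplit]
  refine tendsto_finsetSum _ fun j _ => ?_
  by_cases hj : p j = 0
  -- Frequency zero alone would not suffice, since `f j` need not be integrable for such a letter;
  -- the letter does not occur at all.
  · rw [hj, zero_mul]
    refine tendsto_const_nhds.congr fun n => ?_
    rw [Finset.filter_false_of_mem fun l _ => hx.absent j hj l, Finset.sum_empty, zero_div]
  · refine ((hx.tendsto j).mul ((hy j hj).comp (hx.tendsto_count hj))).congr fun n => ?_
    rw [sum_filter_eq_sum_count, Function.comp_apply]
    rcases Nat.eq_zero_or_pos (Nat.count (fun k => x k = j) n) with h0 | h0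
    · simp [h0]
    · have : (Nat.count (fun k => x k = j) n : ℝ) ≠ 0 := (Nat.cast_pos.2 h0).ne'
      field_simp

/-! ### Size-biased weights and the law along a spine -/

/-- The size-biased law of the `j`-th weight. -/
def sizeBias [MeasurableSpace Ω'] (P' : Measure Ω') (V : Ω' → Fin b → ℝ) (j : Fin b) : Measure ℝ :=
  (P'.map fun ω => V ω j).withDensity ENNReal.ofReal

/-- The joint law of the size-biased weights along the branch `x`. -/
def spineLaw [MeasurableSpace Ω'] (P' : Measure Ω') (V : Ω' → Fin b → ℝ) (x : SymbolicSpace b) :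
    Measure (ℕ → ℝ) :=
  Measure.infinitePi fun l => sizeBias P' V (x l)

namespace IsIndependentCascade

variable [MeasurableSpace Ω] [MeasurableSpace Ω'] {P : Measure Ω} {P' : Measure Ω'}
  {X : List (Fin b) → Ω → ℝ} {V : Ω' → Fin b → ℝ}

lemma measurable_weight (hX : IsIndependentCascade P X P' V) (j : Fin b) :
    Measurable fun ω => V ω j := measurable_pi_iff.1 hX.measurable_V j

lemma lintegral_weight (hX : IsIndependentCascade P X P' V) (j : Fin b) :
    ∫⁻ ω, ENNReal.ofReal (V ω j) ∂P' = 1 := by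
  have hi : Integrable (fun ω => V ω j) P' := by
    by_contra h
    have := hX.mean_V j
    rw [integral_undef h] at this
    exact zero_ne_one this
  rw [← ofReal_integral_eq_lintegral_ofReal hi (ae_of_all _ fun ω => hX.V_nonneg ω j), hX.mean_V j,
    ENNReal.ofReal_one]

lemma lintegral_sizeBias (hX : IsIndependentCascade P X P' V) (j : Fin b) {f : ℝ → ℝ≥0∞}
    (hf : Measurable f) :
    ∫⁻ t, f t ∂sizeBias P' V j = ∫⁻ ω, ENNReal.ofReal (V ω j) * f (V ω j) ∂P' := by
  rw [sizeBias, lintegral_withDensity_eq_lintegral_mul _ ENNReal.measurable_ofReal hf,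
    lintegral_map (ENNReal.measurable_ofReal.mul hf) (hX.measurable_weight j)]
  rfl

lemma isProbabilityMeasure_sizeBias (hX : IsIndependentCascade P X P' V) (j : Fin b) :
    IsProbabilityMeasure (sizeBias P' V j) := ⟨by
  rw [← lintegral_one, hX.lintegral_sizeBias j measurable_const]
  simpa using hX.lintegral_weight j⟩

lemma integral_sizeBias (hX : IsIndependentCascade P X P' V) (j : Fin b) {f : ℝ → ℝ}
    (hf : Measurable f) : ∫ t, f t ∂sizeBias P' V j = ∫ ω, V ω j * f (V ω j) ∂P' := by
  rw [sizeBias, integral_withDensity_eq_integral_toReal_smul ENNReal.measurable_ofReal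
    (ae_of_all _ fun _ => ENNReal.ofReal_lt_top), integral_map (hX.measurable_weight j).aemeasurable]
  · refine integral_congr_ae (ae_of_all _ fun ω => ?_)
    simp only [ENNReal.toReal_ofReal (hX.V_nonneg ω j), smul_eq_mul]
  · exact (ENNReal.measurable_ofReal.ennreal_toReal.mul hf).aestronglyMeasurable

lemma integrable_sizeBias_iff (hX : IsIndependentCascade P X P' V) (j : Fin b) {f : ℝ → ℝ}
    (hf : Measurable f) :
    Integrable f (sizeBias P' V j) ↔ Integrable (fun ω => V ω j * f (V ω j)) P' := by
  rw [sizeBias, integrable_withDensity_iff_integrable_smul' ENNReal.measurable_ofReal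
    (ae_of_all _ fun _ => ENNReal.ofReal_lt_top),
    integrable_map_measure (f := fun ω => V ω j) ?_ (hX.measurable_weight j).aemeasurable]
  swap
  · exact (ENNReal.measurable_ofReal.ennreal_toReal.mul hf).aestronglyMeasurable
  refine integrable_congr (ae_of_all _ fun ω => ?_)
  simp only [Function.comp_apply, ENNReal.toReal_ofReal (hX.V_nonneg ω j), smul_eq_mul]

omit [MeasurableSpace Ω] in
-- Size-biasing gives no mass to the zeros of the weight, so logarithms along the spine are
-- harmless.
lemma _root_.Cascade.ae_sizeBias_pos (P' : Measure Ω') (V : Ω' → Fin b → ℝ) (j : Fin b) :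
    ∀ᵐ t ∂sizeBias P' V j, 0 < t := by
  rw [sizeBias, ae_withDensity_iff ENNReal.measurable_ofReal]
  exact ae_of_all _ fun t ht => by simpa using ht

/-- The words `w i` are the parents, and they are distinct: only one coordinate of each vector is
used, so dependence between siblings plays no role. -/
lemma lintegral_prod_weights (hX : IsIndependentCascade P X P' V) {ι : Type*} (s : Finset ι)
    (w : ι → List (Fin b)) (hw : Set.InjOn w s) (c : ι → Fin b) (F : ι → ℝ → ℝ≥0∞)
    (hF : ∀ i, Measurable (F i)) :
    ∫⁻ ω, ∏ i ∈ s, F i (X (w i ++ [c i]) ω) ∂P = ∏ i ∈ s, ∫⁻ ω, F i (V ω (c i)) ∂P' := by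
  have hm : ∀ i, Measurable fun v : Fin b → ℝ => F i (v (c i)) := fun i =>
    (hF i).comp (measurable_pi_apply _)
  have hind := ((hX.indep.precomp (g := fun i : s => w i) fun i k h =>
    Subtype.ext (hw i.2 k.2 h)).comp (fun i v => F i (v (c i))) fun i => hm i)
  have h := lintegral_prod_eq_prod_lintegral_of_indepFun Finset.univ _ hind fun i =>
    (hm i).comp (measurable_pi_iff.2 fun j => hX.measurable_X (w i) j)
  rw [← Finset.prod_coe_sort s]
  simp_rw [← Finset.prod_coe_sort s fun i => F i (X (w i ++ [c i]) _)]
  refine h.trans (Finset.prod_congr rfl fun i _ => ?_)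
  exact ((hX.identDistrib (w i)).comp (hm i)).lintegral_eq

lemma density_nonneg (hX : IsIndependentCascade P X P' V) (n : ℕ) (ω : Ω) (x : SymbolicSpace b) :
    0 ≤ density X n ω x :=
  Finset.prod_nonneg fun k _ => by rw [pre_succ]; exact hX.X_nonneg _ _ _

lemma ofReal_density (hX : IsIndependentCascade P X P' V) (n : ℕ) (ω : Ω) (x : SymbolicSpace b) :
    ENNReal.ofReal (density X n ω x) =
      ∏ k ∈ Finset.range n, ENNReal.ofReal (X (pre x k ++ [x k]) ω) := by
  rw [density, ENNReal.ofReal_prod_of_nonneg fun k _ => by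
    rw [pre_succ]; exact hX.X_nonneg _ _ _]
  simp_rw [pre_succ]

lemma measurable_X_pre (hX : IsIndependentCascade P X P' V) (x : SymbolicSpace b) (k : ℕ) :
    Measurable fun ω => X (pre x (k + 1)) ω := by
  rw [pre_succ]; exact hX.measurable_X _ _

lemma measurable_density (hX : IsIndependentCascade P X P' V) (n : ℕ) (x : SymbolicSpace b) :
    Measurable fun ω => density X n ω x :=
  Finset.measurable_prod _ fun k _ => hX.measurable_X_pre x k

lemma pre_injective (x : SymbolicSpace b) : Function.Injective (pre x) := fun m n h => by
  simpa using congrArg List.length h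

/-- Change of measure along the branch `x`. -/
lemma lintegral_density_mul (hX : IsIndependentCascade P X P' V) (n : ℕ) (x : SymbolicSpace b)
    {H : (Fin n → ℝ) → ℝ≥0∞} (hH : Measurable H) :
    ∫⁻ ω, ENNReal.ofReal (density X n ω x) * H (fun l => X (pre x (l + 1)) ω) ∂P =
      ∫⁻ y, H (fun l => y l) ∂spineLaw P' V x := by
  have := hX.isProbabilityMeasure_sizeBias
  have hmv : Measurable fun ω (l : Fin n) => X (pre x (l + 1)) ω :=
    measurable_pi_iff.2 fun l => hX.measurable_X_pre x l
  have hd : Measurable fun ω => ENNReal.ofReal (density X n ω x) :=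
    (hX.measurable_density n x).ennreal_ofReal
  -- It is enough to compare the tilted law of the weights with the product law on rectangles, where
  -- independence factorizes the integral.
  have h1 : Measure.pi (fun l : Fin n => sizeBias P' V (x l)) =
      (P.withDensity fun ω => ENNReal.ofReal (density X n ω x)).map
        fun ω (l : Fin n) => X (pre x (l + 1)) ω := by
    refine Measure.pi_eq fun s hs => ?_
    have hS := MeasurableSet.univ_pi hs
    rw [Measure.map_apply hmv hS, withDensity_apply _ (hmv hS), ← lintegral_indicator (hmv hS)]
    have h2 : ∀ ω, ((fun ω (l : Fin n) => X (pre x (l + 1)) ω) ⁻¹' Set.univ.pi s).indicator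
        (fun ω => ENNReal.ofReal (density X n ω x)) ω =
        ∏ l : Fin n, (ENNReal.ofReal (X (pre x l ++ [x l]) ω) *
          (s l).indicator 1 (X (pre x l ++ [x l]) ω)) := by
      intro ω
      rw [Finset.prod_mul_distrib,
        Fin.prod_univ_eq_prod_range (fun k => ENNReal.ofReal (X (pre x k ++ [x k]) ω)) n,
        ← hX.ofReal_density]
      by_cases h : ∀ l : Fin n, X (pre x l ++ [x l]) ω ∈ s l
      · rw [Set.indicator_of_mem, Finset.prod_eq_one, mul_one]
        · exact fun l _ => Set.indicator_of_mem (h l) _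
        · simpa [pre_succ] using! h
      · rw [Set.indicator_of_notMem]
        · push Not at h
          obtain ⟨l, hl⟩ := h
          rw [Finset.prod_eq_zero (Finset.mem_univ l) (Set.indicator_of_notMem hl _), mul_zero]
        · simpa [pre_succ] using! h
    simp_rw [h2]
    rw [hX.lintegral_prod_weights Finset.univ (fun l : Fin n => pre x l)
      (fun i _ k _ h => Fin.ext (pre_injective x h)) (fun l => x l)
      (fun l t => ENNReal.ofReal t * (s l).indicator 1 t)
      fun l => ENNReal.measurable_ofReal.mul (measurable_one.indicator (hs l))]
    refine Finset.prod_congr rfl fun l _ => ?_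
    rw [← lintegral_indicator_one (hs l),
      hX.lintegral_sizeBias _ (measurable_one.indicator (hs l))]
  have h3 : (spineLaw P' V x).map (fun y (l : Fin n) => y l) =
      Measure.pi fun l : Fin n => sizeBias P' V (x l) := by
    rw [spineLaw, Measure.map_infinitePi_infinitePi_of_inj (P := fun l => sizeBias P' V (x l))
      Fin.val_injective, Measure.infinitePi_eq_pi]
  rw [← lintegral_map hH (measurable_pi_iff.2 fun l => measurable_pi_apply _), h3, h1,
    lintegral_map hH hmv, lintegral_withDensity_eq_lintegral_mul _ hd]
  · rfl
  · exact hH.comp hmv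

end IsIndependentCascade

end Cascade

namespace Cascade

variable {b : ℕ} {ν : Measure (SymbolicSpace b)} {Ω Ω' : Type*}

/-! ### The mean of `V log V` -/

lemma extExpectation_of_integrable [MeasurableSpace Ω'] {P' : Measure Ω'} {f : Ω' → ℝ}
    (hf : Integrable f P') : extExpectation P' f = ((∫ ω, f ω ∂P' : ℝ) : EReal) := by
  have h1 : ∫⁻ ω, ENNReal.ofReal (f ω) ∂P' ≠ ∞ :=
    ne_top_of_le_ne_top hf.2.ne (lintegral_mono fun ω => Real.ofReal_le_enorm _)
  have h2 : ∫⁻ ω, ENNReal.ofReal (-f ω) ∂P' ≠ ∞ :=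
    ne_top_of_le_ne_top hf.neg.2.ne (lintegral_mono fun ω => Real.ofReal_le_enorm _)
  rw [extExpectation, integral_eq_lintegral_pos_part_sub_lintegral_neg_part hf, EReal.coe_sub,
    EReal.coe_ennreal_toReal h1, EReal.coe_ennreal_toReal h2]

lemma integrable_of_lintegral_ofReal [MeasurableSpace Ω'] {P' : Measure Ω'} {f : Ω' → ℝ}
    (hf : Measurable f) (h1 : ∫⁻ ω, ENNReal.ofReal (f ω) ∂P' ≠ ∞)
    (h2 : ∫⁻ ω, ENNReal.ofReal (-f ω) ∂P' ≠ ∞) : Integrable f P' := by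
  refine ⟨hf.aestronglyMeasurable, lt_of_le_of_lt (lintegral_mono fun ω => ?_)
    (b := ∫⁻ ω, (ENNReal.ofReal (f ω) + ENNReal.ofReal (-f ω)) ∂P') ?_⟩
  · rw [Real.enorm_eq_ofReal_abs]
    rcases abs_choice (f ω) with h | h <;> rw [h]
    · exact le_self_add
    · exact le_add_self
  · rw [lintegral_add_left hf.ennreal_ofReal]
    exact ENNReal.add_lt_top.2 ⟨h1.lt_top, h2.lt_top⟩

lemma neg_one_le_mul_log {t : ℝ} (ht : 0 ≤ t) : -1 ≤ t * Real.log t := by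
  have := negMulLog_le_one ht
  rw [Real.negMulLog] at this
  linarith

lemma neg_one_le_mul_min_log {t K : ℝ} (ht : 0 ≤ t) (hK : 0 ≤ K) :
    -1 ≤ t * min (Real.log t) K := by
  rcases min_choice (Real.log t) K with h | h <;> rw [h]
  · exact neg_one_le_mul_log ht
  · nlinarith

lemma ereal_coe_sum {ι : Type*} (s : Finset ι) (f : ι → ℝ) :
    ((∑ i ∈ s, f i : ℝ) : EReal) = ∑ i ∈ s, (f i : EReal) := by
  classical
  induction s using Finset.induction_on with
  | empty => simp
  | insert i s hi ih => rw [Finset.sum_insert hi, Finset.sum_insert hi, EReal.coe_add, ih]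

namespace IsIndependentCascade

variable [MeasurableSpace Ω] [MeasurableSpace Ω'] {P : Measure Ω} {P' : Measure Ω'}
  [IsProbabilityMeasure P'] {X : List (Fin b) → Ω → ℝ} {V : Ω' → Fin b → ℝ}

lemma lintegral_neg_mul_log_ne_top (hX : IsIndependentCascade P X P' V) (j : Fin b) :
    ∫⁻ ω, ENNReal.ofReal (-(V ω j * Real.log (V ω j))) ∂P' ≠ ∞ := by
  refine ne_top_of_le_ne_top ENNReal.one_ne_top
    (b := 1) ((lintegral_mono (g := fun _ => 1) fun ω => ?_).trans (by simp))
  rw [← ENNReal.ofReal_one]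
  exact ENNReal.ofReal_le_ofReal (by linarith [neg_one_le_mul_log (hX.V_nonneg ω j)])

omit [IsProbabilityMeasure P'] in
lemma measurable_mul_log (hX : IsIndependentCascade P X P' V) (j : Fin b) :
    Measurable fun ω => V ω j * Real.log (V ω j) :=
  (hX.measurable_weight j).mul (Real.measurable_log.comp (hX.measurable_weight j))

omit [IsProbabilityMeasure P'] in
lemma measurable_mul_min_log (hX : IsIndependentCascade P X P' V) (j : Fin b) (K : ℝ) :
    Measurable fun ω => V ω j * min (Real.log (V ω j)) K :=
  (hX.measurable_weight j).mul
    ((Real.measurable_log.comp (hX.measurable_weight j)).min measurable_const)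

lemma integrable_mul_log (hX : IsIndependentCascade P X P' V) {j : Fin b}
    (h : ∫⁻ ω, ENNReal.ofReal (V ω j * Real.log (V ω j)) ∂P' ≠ ∞) :
    Integrable (fun ω => V ω j * Real.log (V ω j)) P' :=
  integrable_of_lintegral_ofReal (hX.measurable_mul_log j) h (hX.lintegral_neg_mul_log_ne_top j)

lemma extExpectation_mul_log_ne_bot (hX : IsIndependentCascade P X P' V) (j : Fin b) :
    extExpectation P' (fun ω => V ω j * Real.log (V ω j)) ≠ ⊥ := by
  by_cases h : ∫⁻ ω, ENNReal.ofReal (V ω j * Real.log (V ω j)) ∂P' = ∞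
  · rw [extExpectation, h, ← EReal.coe_ennreal_toReal (hX.lintegral_neg_mul_log_ne_top j),
      EReal.coe_ennreal_top, EReal.top_sub_coe]
    exact top_ne_bot
  · rw [extExpectation_of_integrable (hX.integrable_mul_log h)]
    exact EReal.coe_ne_bot _

lemma weightEntropy_eq_sum (hX : IsIndependentCascade P X P' V)
    (h : ∀ j, ν.real (cyl [j]) ≠ 0 → ∫⁻ ω, ENNReal.ofReal (V ω j * Real.log (V ω j)) ∂P' ≠ ∞) :
    weightEntropy P' V ν =
      ((∑ j, ν.real (cyl [j]) * ∫ ω, V ω j * Real.log (V ω j) ∂P' : ℝ) : EReal) := by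
  rw [weightEntropy, ereal_coe_sum]
  refine Finset.sum_congr rfl fun j _ => ?_
  by_cases hj : ν.real (cyl [j]) = 0
  · rw [hj]; simp
  · rw [extExpectation_of_integrable (hX.integrable_mul_log (h j hj)), mul_comm, EReal.coe_mul]

/-- Since `t log t ≥ -1`, no other term is `⊥`, so the infinite term cannot be absorbed by the
convention `⊤ + ⊥ = ⊥`. -/
lemma weightEntropy_eq_top (hX : IsIndependentCascade P X P' V) {j : Fin b}
    (hj : ν.real (cyl [j]) ≠ 0)
    (h : ∫⁻ ω, ENNReal.ofReal (V ω j * Real.log (V ω j)) ∂P' = ∞) :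
    weightEntropy P' V ν = ⊤ := by
  have hp : ∀ k, 0 ≤ ν.real (cyl [k]) := fun k => measureReal_nonneg
  rw [weightEntropy, ← Finset.add_sum_erase _ _ (Finset.mem_univ j), extExpectation, h,
    ← EReal.coe_ennreal_toReal (hX.lintegral_neg_mul_log_ne_top j), EReal.coe_ennreal_top,
    EReal.top_sub_coe, EReal.top_mul_coe_of_pos ((hp j).lt_of_ne' hj), EReal.top_add_of_ne_bot]
  refine Finset.sum_induction _ (· ≠ ⊥) (fun x y hx hy => EReal.add_ne_bot_iff.2 ⟨hx, hy⟩)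
    EReal.zero_ne_bot fun k _ => ?_
  rcases (hp k).eq_or_lt with h0 | h0
  · rw [← h0]; simp
  · have := hX.extExpectation_mul_log_ne_bot k
    induction h1 : extExpectation P' (fun ω => V ω k * Real.log (V ω k)) with
    | bot => exact absurd h1 this
    | coe x => rw [← EReal.coe_mul]; exact EReal.coe_ne_bot _
    | top => rw [EReal.top_mul_coe_of_pos h0]; exact top_ne_bot

lemma of_weightEntropy_lt (hX : IsIndependentCascade P X P' V) {a : ℝ}
    (h : weightEntropy P' V ν < a) :
    (∀ j, ν.real (cyl [j]) ≠ 0 → Integrable (fun ω => V ω j * Real.log (V ω j)) P') ∧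
      ∑ j, ν.real (cyl [j]) * ∫ ω, V ω j * Real.log (V ω j) ∂P' < a := by
  have hfin : ∀ j, ν.real (cyl [j]) ≠ 0 →
      ∫⁻ ω, ENNReal.ofReal (V ω j * Real.log (V ω j)) ∂P' ≠ ∞ := fun j hj htop =>
    absurd (hX.weightEntropy_eq_top hj htop) (h.trans (EReal.coe_lt_top a)).ne
  refine ⟨fun j hj => hX.integrable_mul_log (hfin j hj), ?_⟩
  rwa [hX.weightEntropy_eq_sum hfin, EReal.coe_lt_coe_iff] at h

omit [IsProbabilityMeasure P'] in
lemma integrable_weight (hX : IsIndependentCascade P X P' V) (j : Fin b) :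
    Integrable (fun ω => V ω j) P' := by
  by_contra h
  have := hX.mean_V j
  rw [integral_undef h] at this
  exact zero_ne_one this

lemma integrable_mul_min_log (hX : IsIndependentCascade P X P' V) (j : Fin b) {K : ℝ}
    (hK : 0 ≤ K) : Integrable (fun ω => V ω j * min (Real.log (V ω j)) K) P' := by
  refine Integrable.mono' ((integrable_const (1 : ℝ)).add ((hX.integrable_weight j).mul_const K))
    (hX.measurable_mul_min_log j K).aestronglyMeasurable (ae_of_all _ fun ω => ?_)
  have h0 := hX.V_nonneg ω j
  have h1 := neg_one_le_mul_min_log h0 hK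
  have h2 : V ω j * min (Real.log (V ω j)) K ≤ V ω j * K :=
    mul_le_mul_of_nonneg_left (min_le_right _ _) h0
  have h3 : 0 ≤ V ω j * K := by positivity
  rw [Real.norm_eq_abs, abs_le]
  constructor <;> simp only [Pi.add_apply] <;> linarith

lemma tendsto_integral_mul_min_log (hX : IsIndependentCascade P X P' V) {j : Fin b}
    (h : Integrable (fun ω => V ω j * Real.log (V ω j)) P') :
    Tendsto (fun K : ℕ => ∫ ω, V ω j * min (Real.log (V ω j)) K ∂P') atTop
      (𝓝 (∫ ω, V ω j * Real.log (V ω j) ∂P')) := by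
  refine tendsto_integral_of_dominated_convergence
    (fun ω => 1 + |V ω j * Real.log (V ω j)|)
    (fun K => (hX.measurable_mul_min_log j K).aestronglyMeasurable)
    ((integrable_const _).add h.abs) (fun K => ae_of_all _ fun ω => ?_)
    (ae_of_all _ fun ω => ?_)
  · have h0 := hX.V_nonneg ω j
    have h1 := neg_one_le_mul_min_log h0 (K.cast_nonneg (α := ℝ))
    have h2 : V ω j * min (Real.log (V ω j)) K ≤ V ω j * Real.log (V ω j) :=
      mul_le_mul_of_nonneg_left (min_le_left _ _) h0
    have h3 := le_abs_self (V ω j * Real.log (V ω j))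
    have h4 := abs_nonneg (V ω j * Real.log (V ω j))
    rw [Real.norm_eq_abs, abs_le]
    constructor <;> linarith
  · refine tendsto_const_nhds.congr' ?_
    obtain ⟨L, hL⟩ := exists_nat_ge (Real.log (V ω j))
    filter_upwards [eventually_ge_atTop L] with K hK
    rw [min_eq_left (hL.trans (Nat.cast_le.2 hK))]

lemma tendsto_integral_mul_min_log_atTop (hX : IsIndependentCascade P X P' V) {j : Fin b}
    (h : ∫⁻ ω, ENNReal.ofReal (V ω j * Real.log (V ω j)) ∂P' = ∞) :
    Tendsto (fun K : ℕ => ∫ ω, V ω j * min (Real.log (V ω j)) K ∂P') atTop atTop := by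
  have h1 : Tendsto (fun K : ℕ => ∫⁻ ω, ENNReal.ofReal (V ω j * min (Real.log (V ω j)) K + 1) ∂P')
      atTop (𝓝 (∫⁻ ω, ENNReal.ofReal (V ω j * Real.log (V ω j) + 1) ∂P')) := by
    refine lintegral_tendsto_of_tendsto_of_monotone
      (fun K => ((hX.measurable_mul_min_log j K).add_const 1).ennreal_ofReal.aemeasurable)
      (ae_of_all _ fun ω K L hKL => ?_) (ae_of_all _ fun ω => ?_)
    · have := hX.V_nonneg ω j
      dsimp only
      gcongr
    · refine tendsto_const_nhds.congr' ?_
      obtain ⟨L, hL⟩ := exists_nat_ge (Real.log (V ω j))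
      filter_upwards [eventually_ge_atTop L] with K hK
      rw [min_eq_left (hL.trans (Nat.cast_le.2 hK))]
  have h2 : ∫⁻ ω, ENNReal.ofReal (V ω j * Real.log (V ω j) + 1) ∂P' = ∞ :=
    top_unique (h ▸ lintegral_mono fun ω => ENNReal.ofReal_le_ofReal (by linarith))
  have h3 : ∀ K : ℕ, ∫⁻ ω, ENNReal.ofReal (V ω j * min (Real.log (V ω j)) K + 1) ∂P' =
      ENNReal.ofReal (∫ ω, V ω j * min (Real.log (V ω j)) K ∂P' + 1) := fun K => by
    have hi := hX.integrable_mul_min_log j (K.cast_nonneg (α := ℝ))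
    have hi' : Integrable (fun ω => V ω j * min (Real.log (V ω j)) K + 1) P' :=
      hi.add (integrable_const _)
    rw [← ofReal_integral_eq_lintegral_ofReal hi' (ae_of_all _ fun ω => ?_),
      integral_add hi (integrable_const _)]
    · simp
    · have := neg_one_le_mul_min_log (hX.V_nonneg ω j) (K.cast_nonneg (α := ℝ))
      simp only [Pi.zero_apply]
      linarith
  simp_rw [h3, h2] at h1
  rw [ENNReal.tendsto_ofReal_nhds_top] at h1
  simpa using tendsto_atTop_add_const_right _ (-1) h1

/-- Truncating the logarithm makes all means finite, so the strong law applies even when `E (V_j log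
V_j)` is infinite. If one such mean is infinite with positive frequency, its truncations diverge,
while the other terms stay above `-ν [k]`. -/
lemma exists_lt_of_lt_weightEntropy (hX : IsIndependentCascade P X P' V) {a : ℝ}
    (h : a < weightEntropy P' V ν) :
    ∃ K : ℕ, a < ∑ j, ν.real (cyl [j]) * ∫ ω, V ω j * min (Real.log (V ω j)) K ∂P' := by
  have hp : ∀ k, 0 ≤ ν.real (cyl [k]) := fun k => measureReal_nonneg
  by_cases hfin : ∀ j, ν.real (cyl [j]) ≠ 0 →
      ∫⁻ ω, ENNReal.ofReal (V ω j * Real.log (V ω j)) ∂P' ≠ ∞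
  · rw [hX.weightEntropy_eq_sum hfin, EReal.coe_lt_coe_iff] at h
    have hlim : Tendsto (fun K : ℕ => ∑ j, ν.real (cyl [j]) *
        ∫ ω, V ω j * min (Real.log (V ω j)) K ∂P') atTop
        (𝓝 (∑ j, ν.real (cyl [j]) * ∫ ω, V ω j * Real.log (V ω j) ∂P')) := by
      refine tendsto_finsetSum _ fun j _ => ?_
      by_cases hj : ν.real (cyl [j]) = 0
      · simp [hj]
      · exact (hX.tendsto_integral_mul_min_log (hX.integrable_mul_log (hfin j hj))).const_mul _
    exact (hlim.eventually (lt_mem_nhds h)).exists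
  · push Not at hfin
    obtain ⟨j, hj, htop⟩ := hfin
    have hlim := (hX.tendsto_integral_mul_min_log_atTop htop).const_mul_atTop
      ((hp j).lt_of_ne' hj)
    obtain ⟨K, hK⟩ := (hlim.eventually_gt_atTop
      (a + ∑ k ∈ Finset.univ.erase j, ν.real (cyl [k]))).exists
    refine ⟨K, ?_⟩
    rw [← Finset.add_sum_erase _ _ (Finset.mem_univ j)]
    have h1 : -∑ k ∈ Finset.univ.erase j, ν.real (cyl [k]) ≤ ∑ k ∈ Finset.univ.erase j,
        ν.real (cyl [k]) * ∫ ω, V ω k * min (Real.log (V ω k)) K ∂P' := by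
      rw [← Finset.sum_neg_distrib]
      refine Finset.sum_le_sum fun k _ => ?_
      have h2 : -1 ≤ ∫ ω, V ω k * min (Real.log (V ω k)) K ∂P' := by
        have := integral_mono (μ := P') (integrable_const (-1 : ℝ))
          (hX.integrable_mul_min_log k (K.cast_nonneg (α := ℝ)))
          fun ω => neg_one_le_mul_min_log (hX.V_nonneg ω k) K.cast_nonneg
        simpa using this
      nlinarith [hp k]
    linarith

end IsIndependentCascade

end Cascade

namespace Cascade

variable {b : ℕ} {Ω Ω' : Type*}

/-! ### Measurability of the densities and martingale convergence of the masses of cylinders -/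

/-- Measurability is asked only of the first `n` generations, so that the statement also applies to
the `σ`-algebra of the past and yields adaptedness. -/
lemma measurable_density_uncurry [MeasurableSpace Ω] {X : List (Fin b) → Ω → ℝ} {n : ℕ}
    (h : ∀ v j, v.length < n → Measurable (X (v ++ [j]))) :
    Measurable fun p : Ω × SymbolicSpace b => density X n p.1 p.2 := by
  refine Finset.measurable_prod _ fun k hk => ?_
  have h1 : Measurable fun q : (Fin (k + 1) → Fin b) × Ω => X (List.ofFn q.1) q.2 := by
    refine measurable_from_prod_countable_right fun u => ?_
    dsimp only
    rw [List.ofFn_succ']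
    simp only [List.concat_eq_append]
    exact h _ _ (by simpa using hk)
  exact h1.comp (((measurable_restrictFin (k + 1)).comp measurable_snd).prodMk measurable_fst)

lemma measurable_density_of_length_lt [MeasurableSpace Ω] {X : List (Fin b) → Ω → ℝ} {n : ℕ}
    (h : ∀ v j, v.length < n → Measurable (X (v ++ [j]))) (x : SymbolicSpace b) :
    Measurable fun ω => density X n ω x :=
  (measurable_density_uncurry h).comp (measurable_id.prodMk measurable_const)

variable [MeasurableSpace Ω] {X : List (Fin b) → Ω → ℝ} (ν : Measure (SymbolicSpace b))

/-- The mass given by `ν_n` to the cylinder `[u]`. -/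
def cylMass (X : List (Fin b) → Ω → ℝ) (u : List (Fin b)) (n : ℕ) (ω : Ω) : ℝ≥0∞ :=
  ∫⁻ x in cyl u, ENNReal.ofReal (density X n ω x) ∂ν

lemma measurable_cylMass [SFinite ν] {n : ℕ} (h : ∀ v j, v.length < n → Measurable (X (v ++ [j])))
    (u : List (Fin b)) : Measurable (cylMass ν X u n) :=
  (measurable_density_uncurry h).ennreal_ofReal.lintegral_prod_right'

variable [IsFiniteMeasure ν]

omit [MeasurableSpace Ω] in
lemma approx_cyl (n : ℕ) (ω : Ω) (u : List (Fin b)) :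
    (approx X ν n ω : Measure (SymbolicSpace b)) (cyl u) = cylMass ν X u n ω :=
  withDensity_apply _ (measurableSet_cyl u)

omit [MeasurableSpace Ω] in
lemma cyl_nil : cyl ([] : List (Fin b)) = Set.univ := by ext x; simp [cyl, pre]

omit [MeasurableSpace Ω] in
lemma approx_univ (n : ℕ) (ω : Ω) :
    (approx X ν n ω : Measure (SymbolicSpace b)) Set.univ = cylMass ν X [] n ω := by
  rw [← approx_cyl, cyl_nil]

omit [MeasurableSpace Ω] in
lemma cylMass_ne_top (n : ℕ) (ω : Ω) (u : List (Fin b)) : cylMass ν X u n ω ≠ ∞ := by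
  rw [← approx_cyl]; exact measure_ne_top _ _

/-! ### The martingale of cylinder masses and its limit -/

namespace IsIndependentCascade

variable [MeasurableSpace Ω'] {P : Measure Ω} [IsProbabilityMeasure P] {P' : Measure Ω'}
  {V : Ω' → Fin b → ℝ}

omit [IsProbabilityMeasure P] in
lemma measurable_vector (hX : IsIndependentCascade P X P' V) (v : List (Fin b)) :
    Measurable fun ω j => X (v ++ [j]) ω := measurable_pi_iff.2 fun j => hX.measurable_X v j

omit [MeasurableSpace Ω] [MeasurableSpace Ω'] in
variable (X) in
/-- The `σ`-algebra generated by the first `n` generations of the cascade. -/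
abbrev _root_.Cascade.pastSigma (n : ℕ) : MeasurableSpace Ω :=
  ⨆ v ∈ {v : List (Fin b) | v.length < n},
    MeasurableSpace.comap (fun ω j => X (v ++ [j]) ω) inferInstance

/-- The natural filtration of the cascade. -/
def filtration (hX : IsIndependentCascade P X P' V) : Filtration ℕ ‹MeasurableSpace Ω› where
  seq n := pastSigma X n
  mono' _ _ hmn := biSup_mono fun _ hv => lt_of_lt_of_le hv hmn
  le' _ := iSup₂_le fun v _ => (hX.measurable_vector v).comap_le

omit [IsProbabilityMeasure P] in
lemma measurable_filtration (hX : IsIndependentCascade P X P' V) {n : ℕ} {v : List (Fin b)}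
    (hv : v.length < n) (j : Fin b) : Measurable[hX.filtration n] (X (v ++ [j])) := by
  have h1 : Measurable[MeasurableSpace.comap (fun ω j => X (v ++ [j]) ω) inferInstance]
      (X (v ++ [j])) := (measurable_pi_apply j).comp (comap_measurable fun ω j => X (v ++ [j]) ω)
  exact h1.mono (le_iSup₂_of_le v hv le_rfl) le_rfl

omit [IsProbabilityMeasure P] in
lemma indep_filtration (hX : IsIndependentCascade P X P' V) (v : List (Fin b)) :
    Indep (hX.filtration v.length)
      (MeasurableSpace.comap (fun ω j => X (v ++ [j]) ω) inferInstance) P := by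
  have h := indep_iSup_of_disjoint (fun v => (hX.measurable_vector v).comap_le)
    ((iIndepFun_iff_iIndep ..).1 hX.indep) (S := {w : List (Fin b) | w.length < v.length})
    (T := {v}) (by simp)
  simpa using! h

omit [IsProbabilityMeasure P] in
-- The new factor has mean one and is independent of the first `n` generations, which determine both
-- `A` and `density X n`.
lemma setLIntegral_density_succ (hX : IsIndependentCascade P X P' V) (n : ℕ)
    (x : SymbolicSpace b) {A : Set Ω} (hA : MeasurableSet[hX.filtration n] A) :
    ∫⁻ ω in A, ENNReal.ofReal (density X (n + 1) ω x) ∂P =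
      ∫⁻ ω in A, ENNReal.ofReal (density X n ω x) ∂P := by
  have hA' := (hX.filtration).le n _ hA
  have hd : Measurable[hX.filtration n] fun ω => ENNReal.ofReal (density X n ω x) :=
    (@measurable_density_of_length_lt b Ω (hX.filtration n) X n
      (fun v j hv => hX.measurable_filtration hv j) x).ennreal_ofReal
  have hind := hX.indep_filtration (pre x n)
  rw [length_pre] at hind
  rw [← lintegral_indicator hA', ← lintegral_indicator hA']
  calc ∫⁻ ω, A.indicator (fun ω => ENNReal.ofReal (density X (n + 1) ω x)) ω ∂P
      = ∫⁻ ω, A.indicator (fun ω => ENNReal.ofReal (density X n ω x)) ω *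
          ENNReal.ofReal (X (pre x n ++ [x n]) ω) ∂P := by
        refine lintegral_congr fun ω => ?_
        by_cases hω : ω ∈ A
        · rw [Set.indicator_of_mem hω, Set.indicator_of_mem hω, hX.ofReal_density,
            hX.ofReal_density, Finset.prod_range_succ]
        · rw [Set.indicator_of_notMem hω, Set.indicator_of_notMem hω, zero_mul]
    _ = (∫⁻ ω, A.indicator (fun ω => ENNReal.ofReal (density X n ω x)) ω ∂P) *
          ∫⁻ ω, ENNReal.ofReal (X (pre x n ++ [x n]) ω) ∂P :=
        lintegral_mul_eq_lintegral_mul_lintegral_of_independent_measurableSpace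
          ((hX.filtration).le n) (hX.measurable_vector (pre x n)).comap_le hind (hd.indicator hA)
          (ENNReal.measurable_ofReal.comp ((measurable_pi_apply (x n)).comp
            (comap_measurable fun ω j => X (pre x n ++ [j]) ω)))
    _ = _ := by
        have h := hX.lintegral_prod_weights {()} (fun _ => pre x n) (by simp) (fun _ => x n)
          (fun _ => ENNReal.ofReal) fun _ => ENNReal.measurable_ofReal
        simp only [Finset.prod_singleton] at h
        rw [h, hX.lintegral_weight, mul_one]

omit [IsProbabilityMeasure P] in
lemma lintegral_density (hX : IsIndependentCascade P X P' V) (n : ℕ) (x : SymbolicSpace b) :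
    ∫⁻ ω, ENNReal.ofReal (density X n ω x) ∂P = 1 := by
  simp_rw [hX.ofReal_density]
  rw [hX.lintegral_prod_weights _ _ (pre_injective x).injOn x _ fun _ => ENNReal.measurable_ofReal]
  exact Finset.prod_eq_one fun k _ => hX.lintegral_weight _

lemma setLIntegral_cylMass (hX : IsIndependentCascade P X P' V) (n : ℕ) (u : List (Fin b))
    {A : Set Ω} : ∫⁻ ω in A, cylMass ν X u n ω ∂P =
      ∫⁻ x in cyl u, ∫⁻ ω in A, ENNReal.ofReal (density X n ω x) ∂P ∂ν :=
  lintegral_lintegral_swap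
    (measurable_density_uncurry fun v j _ => hX.measurable_X v j).ennreal_ofReal.aemeasurable

lemma lintegral_cylMass (hX : IsIndependentCascade P X P' V) (n : ℕ) (u : List (Fin b)) :
    ∫⁻ ω, cylMass ν X u n ω ∂P = ν (cyl u) := by
  rw [← setLIntegral_univ, hX.setLIntegral_cylMass ν]
  simp [hX.lintegral_density]

lemma martingale_cylMass (hX : IsIndependentCascade P X P' V) (u : List (Fin b)) :
    Martingale (fun n ω => (cylMass ν X u n ω).toReal) hX.filtration P := by
  have hm : ∀ n, Measurable (cylMass ν X u n) := fun n =>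
    measurable_cylMass ν (fun v j _ => hX.measurable_X v j) u
  have hm' : ∀ n, Measurable[hX.filtration n] fun ω => (cylMass ν X u n ω).toReal := fun n =>
    (@measurable_cylMass b Ω (hX.filtration n) X ν _ n
      (fun v j hv => hX.measurable_filtration hv j) u).ennreal_toReal
  have hi : ∀ n, Integrable (fun ω => (cylMass ν X u n ω).toReal) P := fun n =>
    integrable_toReal_of_lintegral_ne_top (hm n).aemeasurable (by
      rw [hX.lintegral_cylMass ν]; exact measure_ne_top _ _)
  have hset : ∀ (n : ℕ) (A : Set Ω), ∫ ω in A, (cylMass ν X u n ω).toReal ∂P =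
      (∫⁻ ω in A, cylMass ν X u n ω ∂P).toReal := fun n A =>
    integral_toReal (hm n).aemeasurable (ae_of_all _ fun ω => (cylMass_ne_top ν n ω u).lt_top)
  refine martingale_nat (fun n => (hm' n).stronglyMeasurable) hi fun n => ?_
  refine ae_eq_condExp_of_forall_setIntegral_eq ((hX.filtration).le n) (hi (n + 1))
    (fun _ _ _ => (hi n).integrableOn) (fun A hA _ => ?_)
    (hm' n).stronglyMeasurable.aestronglyMeasurable
  rw [hset, hset, hX.setLIntegral_cylMass ν, hX.setLIntegral_cylMass ν]
  simp_rw [hX.setLIntegral_density_succ n _ hA]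

/-- These are martingales bounded in `L¹` by `ν [u]`, and there are countably many words `u`. -/
lemma ae_tendsto_cylMass (hX : IsIndependentCascade P X P' V) :
    ∀ᵐ ω ∂P, ∀ u, ∃ c : ℝ, Tendsto (fun n => (cylMass ν X u n ω).toReal) atTop (𝓝 c) := by
  rw [ae_all_iff]
  intro u
  have h := (hX.martingale_cylMass ν u).submartingale.exists_ae_tendsto_of_bdd
    (R := (ν (cyl u)).toNNReal) fun n => by
      rw [ENNReal.coe_toNNReal (measure_ne_top _ _), eLpNorm_one_eq_lintegral_enorm,
        ← hX.lintegral_cylMass ν n u]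
      refine lintegral_mono fun ω => ?_
      rw [Real.enorm_of_nonneg ENNReal.toReal_nonneg]
      exact ENNReal.ofReal_toReal_le
  exact h

lemma ae_tendsto_limitMass (hX : IsIndependentCascade P X P' V) :
    ∀ᵐ ω ∂P, limitMass X ν ω ≠ ∞ ∧
      Tendsto (fun n => cylMass ν X [] n ω) atTop (𝓝 (limitMass X ν ω)) := by
  filter_upwards [hX.ae_tendsto_cylMass ν] with ω hω
  obtain ⟨c, hc⟩ := hω []
  have h1 := ENNReal.tendsto_ofReal hc
  simp_rw [ENNReal.ofReal_toReal (cylMass_ne_top ν _ ω [])] at h1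
  have h2 : limitMass X ν ω = ENNReal.ofReal c := by
    rw [limitMass]
    simp_rw [approx_univ]
    exact h1.limsup_eq
  rw [h2]
  exact ⟨ENNReal.ofReal_ne_top, h1⟩

omit [IsProbabilityMeasure P] in
lemma measurable_limitMass (hX : IsIndependentCascade P X P' V) : Measurable (limitMass X ν) := by
  have h : limitMass X ν = fun ω => limsup (fun n => cylMass ν X [] n ω) atTop := by
    ext ω; rw [limitMass]; simp_rw [approx_univ]
  rw [h]
  exact Measurable.limsup fun n => measurable_cylMass ν (fun v j _ => hX.measurable_X v j) []

lemma lintegral_limitMass_le (hX : IsIndependentCascade P X P' V) :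
    ∫⁻ ω, limitMass X ν ω ∂P ≤ ν Set.univ := by
  calc ∫⁻ ω, limitMass X ν ω ∂P = ∫⁻ ω, liminf (fun n => cylMass ν X [] n ω) atTop ∂P := by
        refine lintegral_congr_ae ?_
        filter_upwards [hX.ae_tendsto_limitMass ν] with ω hω using hω.2.liminf_eq.symm
    _ ≤ liminf (fun n => ∫⁻ ω, cylMass ν X [] n ω ∂P) atTop :=
        lintegral_liminf_le fun n => measurable_cylMass ν (fun v j _ => hX.measurable_X v j) []
    _ = ν Set.univ := by simp_rw [hX.lintegral_cylMass ν, cyl_nil]; simp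

end IsIndependentCascade

end Cascade

namespace Cascade

variable {b : ℕ}

/-! ### Weak convergence from convergence on cylinders -/

lemma isClopen_cyl (u : List (Fin b)) : IsClopen (cyl u) := by
  rw [← List.ofFn_get u, cyl_ofFn]
  exact (isClopen_discrete _).preimage (by fun_prop)

lemma measure_eq_of_cyl {μ μ' : Measure (SymbolicSpace b)} [IsFiniteMeasure μ]
    (h : ∀ u, μ (cyl u) = μ' (cyl u)) : μ = μ' := by
  have hmap : ∀ n, μ.map (fun x (i : Fin n) => x i) = μ'.map (fun x (i : Fin n) => x i) :=
    fun n => Measure.ext_of_singleton fun u => by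
      rw [Measure.map_apply (measurable_restrictFin n) (measurableSet_singleton _),
        Measure.map_apply (measurable_restrictFin n) (measurableSet_singleton _), ← cyl_ofFn, h]
  refine ext_of_generate_finite (⋃ n, {s | MeasurableSet[letterFiltration b n] s}) ?_ ?_ ?_ ?_
  · exact iSup_letterFiltration.symm.trans
      (MeasurableSpace.generateFrom_iUnion_measurableSet _).symm
  · exact isPiSystem_iUnion_of_monotone _
      (fun n => @MeasurableSpace.isPiSystem_measurableSet _ (letterFiltration b n))
      fun m n hmn s hs => (letterFiltration b).mono hmn s hs
  · intro s hs
    obtain ⟨n, B, hB, rfl⟩ := Set.mem_iUnion.1 hs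
    rw [← Measure.map_apply (measurable_restrictFin n) hB, hmap,
      Measure.map_apply (measurable_restrictFin n) hB]
  · rw [← cyl_nil, h]

/-- Cylinders are clopen, so their indicators are admissible continuous test functions. -/
lemma tendsto_real_cyl {ι : Type*} {l : Filter ι} {m : ι → FiniteMeasure (SymbolicSpace b)}
    {M : FiniteMeasure (SymbolicSpace b)} (h : Tendsto m l (𝓝 M)) (u : List (Fin b)) :
    Tendsto (fun i => (m i : Measure (SymbolicSpace b)).real (cyl u)) l
      (𝓝 ((M : Measure (SymbolicSpace b)).real (cyl u))) := by
  have hc : Continuous ((cyl u).indicator (1 : SymbolicSpace b → ℝ)) :=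
    continuous_one.indicator (by simp [(isClopen_cyl u).frontier_eq])
  have := FiniteMeasure.tendsto_iff_forall_integral_tendsto.1 h
    (BoundedContinuousFunction.mkOfCompact ⟨_, hc⟩)
  simpa [integral_indicator_one (measurableSet_cyl u)] using! this

/-- A sequence of finite measures whose values on every cylinder converge is weakly convergent. -/
theorem exists_tendsto_of_tendsto_cyl {m : ℕ → FiniteMeasure (SymbolicSpace b)}
    (h : ∀ u, ∃ c : ℝ, Tendsto (fun n => (m n : Measure (SymbolicSpace b)).real (cyl u)) atTop
      (𝓝 c)) : ∃ M, Tendsto m atTop (𝓝 M) := by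
  choose c hc using h
  have hmass : ∀ n, ((m n).mass : ℝ) = (m n : Measure (SymbolicSpace b)).real (cyl []) :=
    fun n => by rw [cyl_nil]; rfl
  obtain ⟨C, hC⟩ := (hc []).bddAbove_range
  have hK : ∀ n, (m n).mass ≤ C.toNNReal := fun n =>
    NNReal.coe_le_coe.1 ((hmass n ▸ hC ⟨n, rfl⟩ : ((m n).mass : ℝ) ≤ C).trans (Real.le_coe_toNNReal C))
  -- The masses are bounded, so the sequence lies in a weakly compact set. Every cluster point has
  -- the values `c u` on cylinders, which determine it; a unique cluster point in a compact set is
  -- the limit.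
  have hcpt := isCompact_setOfPred_finiteMeasure_le_of_compactSpace (SymbolicSpace b) C.toNNReal
  have hval : ∀ M, MapClusterPt M atTop m → ∀ u, (M : Measure (SymbolicSpace b)).real (cyl u) = c u := by
    intro M hM u
    obtain ⟨U, hU, hUM⟩ := mapClusterPt_iff_ultrafilter.1 hM
    exact tendsto_nhds_unique (tendsto_real_cyl hUM u) ((hc u).mono_left hU)
  obtain ⟨M, -, hM⟩ := hcpt.exists_mapClusterPt_of_frequently (l := atTop) (f := m)
    (Frequently.of_forall hK)
  refine ⟨M, hcpt.tendsto_nhds_of_unique_mapClusterPt (Eventually.of_forall hK) fun M' _ hM' => ?_⟩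
  refine Subtype.ext (show (M' : Measure (SymbolicSpace b)) = M from measure_eq_of_cyl fun u => ?_)
  have := (hval M' hM' u).trans (hval M hM u).symm
  exact (ENNReal.toReal_eq_toReal_iff' (measure_ne_top _ _) (measure_ne_top _ _)).1 this

/-! ### Existence and total mass of the action limit -/

namespace IsIndependentCascade

variable {Ω Ω' : Type*} [MeasurableSpace Ω] [MeasurableSpace Ω'] {P : Measure Ω}
  [IsProbabilityMeasure P] {P' : Measure Ω'} {X : List (Fin b) → Ω → ℝ} {V : Ω' → Fin b → ℝ}
  (ν : Measure (SymbolicSpace b)) [IsFiniteMeasure ν]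

/-- The action limit `Q · ν` exists, and its total mass is the limit of the masses of `ν_n`. -/
theorem exists_isActionLimit (hX : IsIndependentCascade P X P' V) :
    ∃ M : Ω → FiniteMeasure (SymbolicSpace b), IsActionLimit P X ν M ∧
      ∀ᵐ ω ∂P, (M ω : Measure (SymbolicSpace b)) Set.univ = limitMass X ν ω := by
  classical
  have h : ∀ᵐ ω ∂P, ∃ M, Tendsto (fun n => approx X ν n ω) atTop (𝓝 M) := by
    filter_upwards [hX.ae_tendsto_cylMass ν] with ω hω
    refine exists_tendsto_of_tendsto_cyl fun u => ?_
    simp_rw [measureReal_def, approx_cyl]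
    exact hω u
  refine ⟨fun ω => if h : ∃ M, Tendsto (fun n => approx X ν n ω) atTop (𝓝 M) then h.choose else 0,
    ?_, ?_⟩
  · filter_upwards [h] with ω hω
    rw [dif_pos hω]
    exact hω.choose_spec
  · filter_upwards [h, hX.ae_tendsto_limitMass ν] with ω hω h2
    rw [dif_pos hω]
    have h3 := tendsto_real_cyl hω.choose_spec []
    simp_rw [measureReal_def, approx_cyl] at h3
    have h4 := tendsto_nhds_unique h3 ((ENNReal.tendsto_toReal h2.1).comp h2.2)
    rw [← cyl_nil]
    exact (ENNReal.toReal_eq_toReal_iff' (measure_ne_top _ _) h2.1).1 h4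

lemma isQRegular (hX : IsIndependentCascade P X P' V)
    (h : ∫⁻ ω, limitMass X ν ω ∂P = ν Set.univ) : IsQRegular P X ν := by
  obtain ⟨M, hM, hmass⟩ := hX.exists_isActionLimit ν
  exact ⟨M, hM, by rw [lintegral_congr_ae hmass, h]⟩

lemma isQSingular (hX : IsIndependentCascade P X P' V)
    (h : ∫⁻ ω, limitMass X ν ω ∂P = 0) : IsQSingular P X ν := by
  obtain ⟨M, hM, hmass⟩ := hX.exists_isActionLimit ν
  refine ⟨M, hM, ?_⟩
  rw [lintegral_eq_zero_iff (hX.measurable_limitMass ν)] at h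
  filter_upwards [hmass, h] with ω h1 h2
  rw [h2] at h1
  exact Subtype.ext (Measure.measure_univ_eq_zero.1 h1)

end IsIndependentCascade

end Cascade

namespace Cascade

variable {b : ℕ} {Ω Ω' : Type*}

/-! ### Regularity: truncated second moments -/

/-- The density `Q_n`, set to `0` when some `Q_m` with `m ≤ n` exceeds `C exp (a m)`. -/
def truncDensity (X : List (Fin b) → Ω → ℝ) (C a : ℝ) (n : ℕ) (ω : Ω) (x : SymbolicSpace b) :
    ℝ≥0∞ :=
  {p : Ω × SymbolicSpace b | ∀ m ≤ n, density X m p.1 p.2 ≤ C * Real.exp (a * m)}.indicator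
    (fun p => ENNReal.ofReal (density X n p.1 p.2)) (ω, x)

section

variable {X : List (Fin b) → Ω → ℝ} {C a : ℝ} {n : ℕ}

lemma truncDensity_le (ω : Ω) (x : SymbolicSpace b) :
    truncDensity X C a n ω x ≤ ENNReal.ofReal (density X n ω x) :=
  Set.indicator_le_self _ (fun p : Ω × SymbolicSpace b => ENNReal.ofReal (density X n p.1 p.2)) _

lemma truncDensity_of_forall {ω : Ω} {x : SymbolicSpace b}
    (h : ∀ m ≤ n, density X m ω x ≤ C * Real.exp (a * m)) :
    truncDensity X C a n ω x = ENNReal.ofReal (density X n ω x) :=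
  Set.indicator_of_mem (s := {p : Ω × SymbolicSpace b | ∀ m ≤ n,
    density X m p.1 p.2 ≤ C * Real.exp (a * m)}) (a := (ω, x)) h _

lemma truncDensity_of_not_forall {ω : Ω} {x : SymbolicSpace b}
    (h : ¬∀ m ≤ n, density X m ω x ≤ C * Real.exp (a * m)) : truncDensity X C a n ω x = 0 :=
  Set.indicator_of_notMem (s := {p : Ω × SymbolicSpace b | ∀ m ≤ n,
    density X m p.1 p.2 ≤ C * Real.exp (a * m)}) (a := (ω, x)) h _

lemma measurable_truncDensity [MeasurableSpace Ω] (hX : ∀ v j, Measurable (X (v ++ [j]))) :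
    Measurable fun p : Ω × SymbolicSpace b => truncDensity X C a n p.1 p.2 := by
  have hd : ∀ m, Measurable fun p : Ω × SymbolicSpace b => density X m p.1 p.2 := fun m =>
    measurable_density_uncurry fun v j _ => hX v j
  refine (hd n).ennreal_ofReal.indicator ?_
  simp only [Set.ofPred_forall]
  exact MeasurableSet.iInter fun m => MeasurableSet.iInter fun _ =>
    measurableSet_le (hd m) measurable_const

end

namespace IsIndependentCascade

variable [MeasurableSpace Ω] [MeasurableSpace Ω'] {P : Measure Ω} {P' : Measure Ω'}
  {X : List (Fin b) → Ω → ℝ} {V : Ω' → Fin b → ℝ} {C a : ℝ}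

/-- The first `m` factors are replaced by the deterministic truncation bound, which leaves only
weights whose parents lie in generations `m` and later. -/
lemma truncDensity_le_mul_prod (hX : IsIndependentCascade P X P' V) {m n : ℕ} (hm : m ≤ n) (ω : Ω)
    (x : SymbolicSpace b) :
    truncDensity X C a n ω x ≤ ENNReal.ofReal (C * Real.exp (a * m)) *
      ∏ k ∈ Finset.Ico m n, ENNReal.ofReal (X (pre x k ++ [x k]) ω) := by
  by_cases h : ∀ m ≤ n, density X m ω x ≤ C * Real.exp (a * m)
  · rw [truncDensity_of_forall h, hX.ofReal_density, ← Finset.prod_range_mul_prod_Ico _ hm, ← hX.ofReal_density]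
    gcongr
    exact h m hm
  · rw [truncDensity_of_not_forall h]
    exact zero_le

/-- Under the change of measure, the mean of the truncated density is the probability that the spine
products obey the bound up to time `n`. Requiring the bound at all times gives a lower estimate
independent of `n`. -/
lemma spineLaw_le_lintegral_truncDensity (hX : IsIndependentCascade P X P' V) (n : ℕ)
    (x : SymbolicSpace b) :
    spineLaw P' V x {y | ∀ m, ∏ l ∈ Finset.range m, y l ≤ C * Real.exp (a * m)} ≤
      ∫⁻ ω, truncDensity X C a n ω x ∂P := by
  -- The factor `1` for `l ≥ n` only makes the product total; it is never reached when `m ≤ n`.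
  set S : Set (Fin n → ℝ) := {z | ∀ m ≤ n, ∏ l ∈ Finset.range m,
    (if h : l < n then z ⟨l, h⟩ else 1) ≤ C * Real.exp (a * m)}
  have hS : MeasurableSet S := by
    simp only [S, Set.ofPred_forall]
    refine MeasurableSet.iInter fun m => MeasurableSet.iInter fun _ =>
      measurableSet_le (Finset.measurable_prod _ fun l _ => ?_) measurable_const
    split_ifs
    · exact measurable_pi_apply _
    · exact measurable_const
  have hprod : ∀ (z : ℕ → ℝ) (m : ℕ), m ≤ n →
      ∏ l ∈ Finset.range m, (if h : l < n then (fun i : Fin n => z i) ⟨l, h⟩ else 1) =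
        ∏ l ∈ Finset.range m, z l := fun z m hm =>
    Finset.prod_congr rfl fun l hl => dif_pos ((Finset.mem_range.1 hl).trans_le hm)
  have h := hX.lintegral_density_mul n x (measurable_one.indicator hS)
  have h1 : ∀ ω, ENNReal.ofReal (density X n ω x) *
      S.indicator 1 (fun l : Fin n => X (pre x (l + 1)) ω) = truncDensity X C a n ω x := by
    intro ω
    have hmem : (fun l : Fin n => X (pre x (l + 1)) ω) ∈ S ↔
        ∀ m ≤ n, density X m ω x ≤ C * Real.exp (a * m) :=
      forall₂_congr fun m hm => by rw [hprod (fun l => X (pre x (l + 1)) ω) m hm, density]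
    by_cases hω : (fun l : Fin n => X (pre x (l + 1)) ω) ∈ S
    · rw [Set.indicator_of_mem hω, truncDensity_of_forall (hmem.1 hω), Pi.one_apply,
        mul_one]
    · rw [Set.indicator_of_notMem hω, truncDensity_of_not_forall (mt hmem.2 hω),
        mul_zero]
  simp_rw [h1] at h
  have hr : Measurable fun (y : ℕ → ℝ) (l : Fin n) => y l :=
    measurable_pi_iff.2 fun l => measurable_pi_apply _
  rw [h, ← lintegral_map (measurable_one.indicator hS) hr, lintegral_indicator_one hS,
    Measure.map_apply hr hS]
  refine measure_mono fun y hy m hm => ?_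
  rw [hprod y m hm]
  exact hy m

/-- The shared initial weights occur twice in the product; one copy is bounded by the truncation,
and independent weights of mean one remain. The sum over `m` hides the last common generation of `x`
and `y`, which makes integration over `y` immediate. -/
lemma lintegral_truncDensity_mul_le (hX : IsIndependentCascade P X P' V) (hC : 0 ≤ C) (n : ℕ)
    (x y : SymbolicSpace b) :
    ∫⁻ ω, truncDensity X C a n ω x * truncDensity X C a n ω y ∂P ≤
      ∑ m ∈ Finset.range (n + 1), (cyl (pre x m)).indicator
        (fun _ => ENNReal.ofReal (C * Real.exp |a| * Real.exp (a * m))) y := by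
  -- From generation `k` on the two branches have distinct parents. The remaining factors along `x`
  -- and all factors along `y` then involve different vectors, and their product has mean one.
  have key : ∀ k ≤ n, (∀ l, k ≤ l → l < n → pre x l ≠ pre y l) →
      ∫⁻ ω, truncDensity X C a n ω x * truncDensity X C a n ω y ∂P ≤
        ENNReal.ofReal (C * Real.exp (a * k)) := by
    intro k hk hne
    have hinj : Set.InjOn (Sum.elim (pre x) (pre y))
        ((Finset.Ico k n).disjSum (Finset.range n) : Finset (ℕ ⊕ ℕ)) := by
      rintro (i | i) hi (l | l) hl h
      · exact congrArg Sum.inl (pre_injective x h)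
      · have hil : i = l := by simpa using congrArg List.length h
        subst hil
        simp only [Finset.mem_coe, Finset.inl_mem_disjSum, Finset.mem_Ico] at hi
        exact absurd h (hne i hi.1 hi.2)
      · have hil : i = l := by simpa using congrArg List.length h
        subst hil
        simp only [Finset.mem_coe, Finset.inl_mem_disjSum, Finset.mem_Ico] at hl
        exact absurd h.symm (hne i hl.1 hl.2)
      · exact congrArg Sum.inr (pre_injective y h)
    have hprod := hX.lintegral_prod_weights _ _ hinj (Sum.elim x y) (fun _ => ENNReal.ofReal)
      fun _ => ENNReal.measurable_ofReal
    simp only [hX.lintegral_weight, Finset.prod_const_one, Finset.prod_disjSum, Sum.elim_inl,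
      Sum.elim_inr, ← hX.ofReal_density] at hprod
    calc ∫⁻ ω, truncDensity X C a n ω x * truncDensity X C a n ω y ∂P
        ≤ ∫⁻ ω, ENNReal.ofReal (C * Real.exp (a * k)) *
          ((∏ i ∈ Finset.Ico k n, ENNReal.ofReal (X (pre x i ++ [x i]) ω)) *
            ENNReal.ofReal (density X n ω y)) ∂P := by
          refine lintegral_mono fun ω => ?_
          dsimp only
          rw [← mul_assoc]
          gcongr
          · exact hX.truncDensity_le_mul_prod hk ω x
          · exact truncDensity_le ω y
      _ = ENNReal.ofReal (C * Real.exp (a * k)) := by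
          rw [lintegral_const_mul' _ _ ENNReal.ofReal_ne_top, hprod, mul_one]
  have hle : ∀ m ≤ n, pre x m = pre y m →
      ENNReal.ofReal (C * Real.exp |a| * Real.exp (a * m)) ≤
        ∑ m ∈ Finset.range (n + 1), (cyl (pre x m)).indicator
          (fun _ => ENNReal.ofReal (C * Real.exp |a| * Real.exp (a * m))) y := by
    intro m hm h
    refine le_trans (le_of_eq ?_) (Finset.single_le_sum (fun _ _ => zero_le)
      (Finset.mem_range.2 (Nat.lt_succ_of_le hm)))
    rw [Set.indicator_of_mem (mem_cyl_pre.2 h.symm)]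
  by_cases h : pre x n = pre y n
  · refine (key n le_rfl fun l h1 h2 => absurd h1 (not_le.2 h2)).trans
      (le_trans (ENNReal.ofReal_le_ofReal ?_) (hle n le_rfl h))
    have : 1 ≤ Real.exp |a| := Real.one_le_exp (abs_nonneg a)
    have h2 : 0 < Real.exp (a * n) := Real.exp_pos _
    rw [mul_assoc]
    exact mul_le_mul_of_nonneg_left (by nlinarith) hC
  · classical
    have hex : ∃ m, x m ≠ y m ∧ m < n := by
      by_contra hcon
      push Not at hcon
      exact h (pre_eq_iff.2 fun i hi => by_contra fun hne => absurd (hcon i hne) (not_le.2 hi))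
    obtain ⟨hm1, hm2⟩ := Nat.find_spec hex
    set m := Nat.find hex
    have hpre : pre x m = pre y m := pre_eq_iff.2 fun i hi => by_contra fun hne =>
      Nat.find_min hex hi ⟨hne, hi.trans hm2⟩
    -- At the branching generation `m` the two children have the same parent, and sibling weights
    -- may be dependent. The truncation is therefore used at `m + 1`, which costs the factor `exp
    -- |a|`.
    refine (key (m + 1) hm2 fun l h1 _ heq => hm1 (pre_eq_iff.1 heq m h1)).trans
      (le_trans (ENNReal.ofReal_le_ofReal ?_) (hle m hm2.le hpre))
    rw [mul_assoc, ← Real.exp_add]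
    refine mul_le_mul_of_nonneg_left (Real.exp_le_exp.2 ?_) hC
    push_cast
    linarith [le_abs_self a]

end IsIndependentCascade

end Cascade

/-! ### Second moments of the truncated masses and the regular case -/

namespace Cascade

variable {b : ℕ} {Ω Ω' : Type*}

/-- The sequences whose cylinders have measure at most `C exp (-a m)` in every generation `m`. -/
def decaySet (ν : Measure (SymbolicSpace b)) (C a : ℝ) : Set (SymbolicSpace b) :=
  {x | ∀ m : ℕ, ν.real (cyl (pre x m)) ≤ C * Real.exp (-(a * m))}

lemma measurableSet_decaySet (ν : Measure (SymbolicSpace b)) (C a : ℝ) :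
    MeasurableSet (decaySet ν C a) := by
  simp only [decaySet, Set.ofPred_forall]
  exact MeasurableSet.iInter fun m =>
    measurableSet_le (measurable_comp_pre m fun u => ν.real (cyl u)) measurable_const

namespace IsIndependentCascade

variable [MeasurableSpace Ω] [MeasurableSpace Ω'] {P : Measure Ω} {P' : Measure Ω'}
  {X : List (Fin b) → Ω → ℝ} {V : Ω' → Fin b → ℝ}

lemma ae_spineLaw_pos (hX : IsIndependentCascade P X P' V) (x : SymbolicSpace b) :
    ∀ᵐ y ∂spineLaw P' V x, ∀ l, 0 < y l := by
  have := hX.isProbabilityMeasure_sizeBias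
  rw [ae_all_iff]
  intro l
  have h := ae_sizeBias_pos P' V (x l)
  rw [← Measure.infinitePi_map_eval (fun l => sizeBias P' V (x l)) l] at h
  exact ae_of_ae_map (measurable_pi_apply l).aemeasurable h

/-- Under a strict entropy bound, the products of the size-biased weights along a typical branch
grow at most exponentially. -/
lemma ae_spineLaw_exists_prod_le [IsProbabilityMeasure P'] (hX : IsIndependentCascade P X P' V)
    {x : SymbolicSpace b} {p : Fin b → ℝ} (hx : HasLetterFreq x p) {a : ℝ}
    (hi : ∀ j, p j ≠ 0 → Integrable (fun ω => V ω j * Real.log (V ω j)) P')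
    (ha : ∑ j, p j * ∫ ω, V ω j * Real.log (V ω j) ∂P' < a) :
    ∀ᵐ y ∂spineLaw P' V x, ∃ C : ℝ, ∀ m : ℕ,
      ∏ l ∈ Finset.range m, y l ≤ C * Real.exp (a * m) := by
  have := hX.isProbabilityMeasure_sizeBias
  have h := hx.strong_law (sizeBias P' V) (f := fun _ => Real.log) (fun _ => Real.measurable_log)
    fun j hj => (hX.integrable_sizeBias_iff j Real.measurable_log).2 (hi j hj)
  simp_rw [hX.integral_sizeBias _ Real.measurable_log] at h
  filter_upwards [h, hX.ae_spineLaw_pos x] with y hy hpos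
  have hev : ∀ᶠ m : ℕ in atTop, ∏ l ∈ Finset.range m, y l * Real.exp (-a) ≤ 1 := by
    filter_upwards [hy.eventually (gt_mem_nhds ha), eventually_gt_atTop 0] with m hm hm0
    rw [div_lt_iff₀ (Nat.cast_pos.2 hm0)] at hm
    have h1 : ∀ l, y l * Real.exp (-a) = Real.exp (Real.log (y l) - a) := fun l => by
      rw [sub_eq_add_neg, Real.exp_add, Real.exp_log (hpos l)]
    simp_rw [h1]
    rw [← Real.exp_sum, Finset.sum_sub_distrib, Finset.sum_const, Finset.card_range, nsmul_eq_mul,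
      Real.exp_le_one_iff]
    linarith
  obtain ⟨C, hC⟩ := (Filter.isBoundedUnder_of_eventually_le hev).bddAbove_range
  refine ⟨C, fun m => ?_⟩
  have h1 := hC ⟨m, rfl⟩
  dsimp only at h1
  rw [Finset.prod_mul_distrib, Finset.prod_const, Finset.card_range, ← Real.exp_nat_mul] at h1
  calc ∏ l ∈ Finset.range m, y l
      = (∏ l ∈ Finset.range m, y l) * Real.exp (m * -a) * Real.exp (a * m) := by
        rw [mul_assoc, ← Real.exp_add]; ring_nf; simp
    _ ≤ C * Real.exp (a * m) := by gcongr

/-- The mass of the truncated density on the set of exponential decay. -/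
def _root_.Cascade.truncMass (X : List (Fin b) → Ω → ℝ) (ν : Measure (SymbolicSpace b))
    (C a a' : ℝ) (n : ℕ) (ω : Ω) : ℝ≥0∞ :=
  ∫⁻ x in decaySet ν C a', truncDensity X C a n ω x ∂ν

variable (ν : Measure (SymbolicSpace b)) [IsProbabilityMeasure ν]

lemma measurable_truncMass (hX : IsIndependentCascade P X P' V) (C a a' : ℝ) (n : ℕ) :
    Measurable (truncMass X ν C a a' n) :=
  (measurable_truncDensity hX.measurable_X).lintegral_prod_right'

omit [MeasurableSpace Ω] [IsProbabilityMeasure ν] in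
lemma _root_.Cascade.truncMass_le (C a a' : ℝ) (n : ℕ) (ω : Ω) :
    truncMass X ν C a a' n ω ≤ cylMass ν X [] n ω := by
  rw [cylMass, cyl_nil]
  exact (lintegral_mono fun x => truncDensity_le ω x).trans
    (lintegral_mono_set (Set.subset_univ _))

/-- The truncated masses are bounded in `L²`. -/
lemma exists_lintegral_truncMass_sq_le [IsProbabilityMeasure P] (hX : IsIndependentCascade P X P' V)
    {C a a' : ℝ} (hC : 0 ≤ C) (haa' : a < a') :
    ∃ B : ℝ≥0∞, B ≠ ∞ ∧ ∀ n, ∫⁻ ω, truncMass X ν C a a' n ω * truncMass X ν C a a' n ω ∂P ≤ B := by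
  set E := decaySet ν C a'
  set r : ℝ := Real.exp (-(a' - a))
  have hr1 : r < 1 := by rw [← Real.exp_zero]; exact Real.exp_lt_exp.2 (by linarith)
  -- A pair agreeing up to generation `m` costs `C exp |a| exp (a m)`, and the cylinder around `x`
  -- has measure at most `C exp (-a' m)`; the ratio is `r = exp (a - a') < 1`.
  refine ⟨∑' m : ℕ, ENNReal.ofReal (C * Real.exp |a| * C) * ENNReal.ofReal r ^ m, ?_, fun n => ?_⟩
  · rw [ENNReal.tsum_mul_left, ENNReal.tsum_geometric]
    refine ENNReal.mul_ne_top ENNReal.ofReal_ne_top (ENNReal.inv_ne_top.2 ?_)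
    rw [ne_eq, tsub_eq_zero_iff_le, not_le]
    simpa using hr1
  · have hm : Measurable fun p : Ω × SymbolicSpace b => truncDensity X C a n p.1 p.2 :=
      measurable_truncDensity hX.measurable_X
    have hmω : ∀ ω, Measurable fun x => truncDensity X C a n ω x := fun ω =>
      hm.comp (measurable_const.prodMk measurable_id)
    calc ∫⁻ ω, truncMass X ν C a a' n ω * truncMass X ν C a a' n ω ∂P
        = ∫⁻ ω, ∫⁻ x in E, ∫⁻ y in E, truncDensity X C a n ω x * truncDensity X C a n ω y
            ∂ν ∂ν ∂P := by
          refine lintegral_congr fun ω => ?_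
          exact (lintegral_lintegral_mul (hmω ω).aemeasurable (hmω ω).aemeasurable).symm
      _ = ∫⁻ x in E, ∫⁻ ω, ∫⁻ y in E, truncDensity X C a n ω x * truncDensity X C a n ω y
            ∂ν ∂P ∂ν := by
          refine lintegral_lintegral_swap (Measurable.aemeasurable ?_)
          refine Measurable.lintegral_prod_right' (f := fun q : (Ω × SymbolicSpace b) ×
            SymbolicSpace b => truncDensity X C a n q.1.1 q.1.2 * truncDensity X C a n q.1.1 q.2) ?_
          exact (hm.comp measurable_fst).mul
            (hm.comp ((measurable_fst.comp measurable_fst).prodMk measurable_snd))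
      _ = ∫⁻ x in E, ∫⁻ y in E, ∫⁻ ω, truncDensity X C a n ω x * truncDensity X C a n ω y
            ∂P ∂ν ∂ν := by
          refine lintegral_congr fun x => lintegral_lintegral_swap (Measurable.aemeasurable ?_)
          exact (hm.comp (measurable_fst.prodMk measurable_const)).mul hm
      _ ≤ ∫⁻ x in E, ∫⁻ y in E, ∑ m ∈ Finset.range (n + 1), (cyl (pre x m)).indicator
            (fun _ => ENNReal.ofReal (C * Real.exp |a| * Real.exp (a * m))) y ∂ν ∂ν :=
          lintegral_mono fun x => lintegral_mono fun y => hX.lintegral_truncDensity_mul_le hC n x y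
      _ ≤ ∫⁻ x in E, ∑ m ∈ Finset.range (n + 1),
            ENNReal.ofReal (C * Real.exp |a| * C) * ENNReal.ofReal r ^ m ∂ν := by
          refine setLIntegral_mono' (measurableSet_decaySet ν C a') fun x hx => ?_
          rw [lintegral_finsetSum _ fun m _ => measurable_const.indicator (measurableSet_cyl _)]
          refine Finset.sum_le_sum fun m _ => ?_
          rw [lintegral_indicator_const (measurableSet_cyl _)]
          calc ENNReal.ofReal (C * Real.exp |a| * Real.exp (a * m)) *
                ν.restrict E (cyl (pre x m))
              ≤ ENNReal.ofReal (C * Real.exp |a| * Real.exp (a * m)) *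
                ENNReal.ofReal (C * Real.exp (-(a' * m))) := by
                gcongr
                refine (Measure.restrict_apply_le _ _).trans ?_
                rw [← ofReal_measureReal]
                exact ENNReal.ofReal_le_ofReal (hx m)
            _ = _ := by
                rw [← ENNReal.ofReal_mul (by positivity), ← ENNReal.ofReal_pow (Real.exp_pos _).le,
                  ← ENNReal.ofReal_mul (by positivity), ← Real.exp_nat_mul]
                congr 1
                have : Real.exp (m * -(a' - a)) = Real.exp (a * m) * Real.exp (-(a' * m)) := by
                  rw [← Real.exp_add]; ring_nf
                rw [this]; ring
      _ ≤ ∑ m ∈ Finset.range (n + 1),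
            ENNReal.ofReal (C * Real.exp |a| * C) * ENNReal.ofReal r ^ m := by
          rw [setLIntegral_const]
          exact mul_le_of_le_one_right' prob_le_one
      _ ≤ _ := ENNReal.sum_le_tsum _

/-- Uniform second moments give a lower bound for the mean of the limit. -/
lemma le_lintegral_limitMass [IsProbabilityMeasure P] (hX : IsIndependentCascade P X P' V)
    {C a a' : ℝ} (hC : 0 ≤ C) (haa' : a < a') {J : ℝ≥0∞}
    (hJ : ∀ n, J ≤ ∫⁻ ω, truncMass X ν C a a' n ω ∂P) :
    J ≤ ∫⁻ ω, limitMass X ν ω ∂P := by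
  obtain ⟨B, hB, hBn⟩ := hX.exists_lintegral_truncMass_sq_le ν hC haa'
  have hmZ : ∀ n, Measurable (cylMass ν X [] n) := fun n =>
    measurable_cylMass ν (fun v j _ => hX.measurable_X v j) []
  have hlim : Tendsto (fun K : ℕ => ∫⁻ ω, limitMass X ν ω ∂P + B / (K : ℝ≥0∞)) atTop
      (𝓝 (∫⁻ ω, limitMass X ν ω ∂P + B / ∞)) :=
    tendsto_const_nhds.add (ENNReal.Tendsto.const_div ENNReal.tendsto_nat_nhds_top (Or.inr hB))
  rw [ENNReal.div_top, add_zero] at hlim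
  refine ge_of_tendsto hlim ?_
  filter_upwards [eventually_gt_atTop 0] with K hK
  have hK0 : (K : ℝ≥0∞) ≠ 0 := by exact_mod_cast hK.ne'
  have hKt : (K : ℝ≥0∞) ≠ ∞ := ENNReal.natCast_ne_top K
  rw [← tsub_le_iff_right]
  -- Where the truncated mass is at most `K` it is below `min Z_n K`; elsewhere it is at most its
  -- square divided by `K`.
  have h1 : ∀ n, J - B / K ≤ ∫⁻ ω, min (cylMass ν X [] n ω) K ∂P := fun n => by
    rw [tsub_le_iff_right]
    calc J ≤ ∫⁻ ω, truncMass X ν C a a' n ω ∂P := hJ n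
      _ ≤ ∫⁻ ω, (min (cylMass ν X [] n ω) K +
            truncMass X ν C a a' n ω * truncMass X ν C a a' n ω / K) ∂P := by
          refine lintegral_mono fun ω => ?_
          rcases le_total (truncMass X ν C a a' n ω) K with h | h
          · exact le_add_right (le_min (truncMass_le ν C a a' n ω) h)
          · refine le_add_left ?_
            rw [ENNReal.le_div_iff_mul_le (Or.inl hK0) (Or.inl hKt)]
            gcongr
      _ = ∫⁻ ω, min (cylMass ν X [] n ω) K ∂P +
            (∫⁻ ω, truncMass X ν C a a' n ω * truncMass X ν C a a' n ω ∂P) / K := by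
          rw [lintegral_add_left ((hmZ n).min measurable_const)]
          simp_rw [div_eq_mul_inv]
          rw [lintegral_mul_const]
          exact (hX.measurable_truncMass ν C a a' n).mul (hX.measurable_truncMass ν C a a' n)
      _ ≤ _ := by gcongr; exact hBn n
  -- The cap at `K` provides the domination needed for the reverse Fatou lemma.
  calc J - B / K ≤ limsup (fun n => ∫⁻ ω, min (cylMass ν X [] n ω) K ∂P) atTop :=
        le_limsup_of_frequently_le (Frequently.of_forall h1)
    _ ≤ ∫⁻ ω, limsup (fun n => min (cylMass ν X [] n ω) K) atTop ∂P :=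
        limsup_lintegral_le (fun _ => (K : ℝ≥0∞)) (fun n => (hmZ n).min measurable_const)
          (fun n => ae_of_all _ fun ω => min_le_right _ _) (by simp)
    _ ≤ ∫⁻ ω, limitMass X ν ω ∂P := by
        refine lintegral_mono fun ω => ?_
        rw [limitMass]
        simp_rw [approx_univ]
        exact limsup_le_limsup (Eventually.of_forall fun n => min_le_left _ _)

/-- The mean never exceeds one by Fatou's lemma. For the lower bound, one integer `N` serves as the
constant in both truncations, and the mean of the truncated mass is bounded below uniformly in `n`
by `∫ g N`, which recovers the full mass as `N → ∞`. -/
theorem lintegral_limitMass_eq_one [IsProbabilityMeasure P] [IsProbabilityMeasure P']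
    (hX : IsIndependentCascade P X P' V) (hν : Ergodic shift ν)
    (h : weightEntropy P' V ν < entropy ν) : ∫⁻ ω, limitMass X ν ω ∂P = 1 := by
  refine le_antisymm ((hX.lintegral_limitMass_le ν).trans prob_le_one) ?_
  rw [entropy_eq hν.toMeasurePreserving] at h
  obtain ⟨a, ha1, ha2⟩ := EReal.lt_iff_exists_real_btwn.1 h
  obtain ⟨hi, hsum⟩ := hX.of_weightEntropy_lt ha1
  obtain ⟨a', haa', ha'⟩ := exists_between (EReal.coe_lt_coe_iff.1 ha2)
  have := hX.isProbabilityMeasure_sizeBias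
  have hprob : ∀ x, IsProbabilityMeasure (spineLaw P' V x) := fun x => by
    unfold spineLaw; infer_instance
  set g : ℕ → SymbolicSpace b → ℝ≥0∞ := fun N x =>
    (decaySet ν N a').indicator (fun x => ⨅ n, ∫⁻ ω, truncDensity X N a n ω x ∂P) x
  have hmt : ∀ N n : ℕ, Measurable fun x => ∫⁻ ω, truncDensity X N a n ω x ∂P := fun N n =>
    ((measurable_truncDensity hX.measurable_X).comp measurable_swap).lintegral_prod_right'
  have hmg : ∀ N, Measurable (g N) := fun N =>
    (Measurable.iInf fun n => hmt N n).indicator (measurableSet_decaySet ν N a')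
  have hg1 : ∀ᵐ x ∂ν, 1 ≤ liminf (fun N => g N x) atTop := by
    -- For typical `x`, almost every spine satisfies the growth bound with some constant, so the
    -- events `S N` increase to probability one; moreover `x` lies in the decay set as soon as `N ≥
    -- C`.
    filter_upwards [ae_hasLetterFreq hν, ae_exists_cyl_le hν ha'] with x hx ⟨C, hC⟩
    set S : ℕ → Set (ℕ → ℝ) := fun N =>
      {y | ∀ m : ℕ, ∏ l ∈ Finset.range m, y l ≤ N * Real.exp (a * m)}
    have hSmono : Monotone S := fun M N hMN y hy m =>
      (hy m).trans (by gcongr)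
    have hSlim : Tendsto (fun N => spineLaw P' V x (S N)) atTop (𝓝 1) := by
      have h1 := tendsto_measure_iUnion_atTop (μ := spineLaw P' V x) hSmono
      have h2 : spineLaw P' V x (⋃ N, S N) = 1 := by
        rw [← measure_univ (μ := spineLaw P' V x)]
        refine measure_congr (Filter.eventuallyEq_univ.2 ?_)
        filter_upwards [hX.ae_spineLaw_exists_prod_le hx hi hsum] with y ⟨D, hD⟩
        obtain ⟨N, hN⟩ := exists_nat_ge D
        exact Set.mem_iUnion.2 ⟨N, fun m => (hD m).trans (by gcongr)⟩
      rwa [h2] at h1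
    rw [← hSlim.liminf_eq]
    refine liminf_le_liminf ?_
    obtain ⟨L, hL⟩ := exists_nat_ge C
    filter_upwards [eventually_ge_atTop L] with N hN
    have hmem : x ∈ decaySet ν N a' := fun m => (hC m).trans (by
      have : C ≤ N := hL.trans (Nat.cast_le.2 hN)
      gcongr)
    simp only [g, Set.indicator_of_mem hmem]
    exact le_iInf fun n => hX.spineLaw_le_lintegral_truncDensity n x
  calc (1 : ℝ≥0∞) = ∫⁻ _x, 1 ∂ν := by simp
    _ ≤ ∫⁻ x, liminf (fun N => g N x) atTop ∂ν := lintegral_mono_ae hg1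
    _ ≤ liminf (fun N => ∫⁻ x, g N x ∂ν) atTop := lintegral_liminf_le hmg
    _ ≤ ∫⁻ ω, limitMass X ν ω ∂P := by
        refine liminf_le_of_le (by isBoundedDefault) fun J hJ => ?_
        obtain ⟨N, hN⟩ := hJ.exists
        refine hN.trans (hX.le_lintegral_limitMass ν N.cast_nonneg haa' fun n => ?_)
        rw [lintegral_indicator (measurableSet_decaySet ν N a')]
        unfold truncMass
        rw [lintegral_lintegral_swap (measurable_truncDensity hX.measurable_X).aemeasurable]
        exact lintegral_mono fun x => iInf_le _ n

end IsIndependentCascade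

end Cascade

namespace Cascade

variable {b : ℕ} {Ω Ω' : Type*}

/-! ### Singularity -/

lemma density_eq_of_pre_eq (X : List (Fin b) → Ω → ℝ) {n : ℕ} (ω : Ω) {x y : SymbolicSpace b}
    (h : pre x n = pre y n) : density X n ω x = density X n ω y := by
  refine Finset.prod_congr rfl fun k hk => ?_
  have : pre x (k + 1) = pre y (k + 1) := pre_eq_iff.2 fun i hi =>
    pre_eq_iff.1 h i (by have := Finset.mem_range.1 hk; omega)
  rw [this]

/-- The density `Q_n` is constant on cylinders of generation `n`, so the total mass is at least that
of the single cylinder around `x`. -/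
lemma density_mul_cyl_le (X : List (Fin b) → Ω → ℝ) (ν : Measure (SymbolicSpace b)) (n : ℕ) (ω : Ω)
    (x : SymbolicSpace b) :
    ENNReal.ofReal (density X n ω x) * ν (cyl (pre x n)) ≤ cylMass ν X [] n ω := by
  rw [cylMass, cyl_nil, ← setLIntegral_const]
  calc ∫⁻ _y in cyl (pre x n), ENNReal.ofReal (density X n ω x) ∂ν
      = ∫⁻ y in cyl (pre x n), ENNReal.ofReal (density X n ω y) ∂ν :=
        setLIntegral_congr_fun (measurableSet_cyl _) fun y hy => by
          rw [density_eq_of_pre_eq X ω (mem_cyl_pre.1 hy)]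
    _ ≤ _ := lintegral_mono_set (Set.subset_univ _)

namespace IsIndependentCascade

variable [MeasurableSpace Ω] [MeasurableSpace Ω'] {P : Measure Ω} {P' : Measure Ω'}
  {X : List (Fin b) → Ω → ℝ} {V : Ω' → Fin b → ℝ}

/-- The products of the size-biased weights along a typical branch grow at a rate given by the
truncated mean of `V log V`. -/
lemma tendsto_spineLaw_prod_lt [IsProbabilityMeasure P'] (hX : IsIndependentCascade P X P' V)
    {x : SymbolicSpace b} {p : Fin b → ℝ} (hx : HasLetterFreq x p) {a : ℝ} {K : ℕ}
    (ha : a < ∑ j, p j * ∫ ω, V ω j * min (Real.log (V ω j)) K ∂P') (R : ℝ) :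
    Tendsto (fun n : ℕ => spineLaw P' V x
      {y | ∏ l ∈ Finset.range n, y l < R * Real.exp (a * n)}) atTop (𝓝 0) := by
  have := hX.isProbabilityMeasure_sizeBias
  have : IsProbabilityMeasure (spineLaw P' V x) := by unfold spineLaw; infer_instance
  have hm : Measurable fun t : ℝ => min (Real.log t) K := Real.measurable_log.min measurable_const
  have h := hx.strong_law (sizeBias P' V) (f := fun _ t => min (Real.log t) K) (fun _ => hm)
    fun j _ => (hX.integrable_sizeBias_iff j hm).2 (hX.integrable_mul_min_log j K.cast_nonneg)
  simp_rw [hX.integral_sizeBias _ hm] at h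
  obtain ⟨a', ha1, ha2⟩ := exists_between ha
  rw [← measure_empty (μ := spineLaw P' V x)]
  refine tendsto_measure_of_ae_tendsto_indicator_of_isFiniteMeasure atTop MeasurableSet.empty
    (fun n => measurableSet_lt (Finset.measurable_prod _ fun l _ => measurable_pi_apply l)
      measurable_const) ?_
  filter_upwards [h, hX.ae_spineLaw_pos x] with y hy hpos
  have hexp : Tendsto (fun n : ℕ => Real.exp ((a' - a) * n)) atTop atTop :=
    Real.tendsto_exp_atTop.comp
      (tendsto_natCast_atTop_atTop.const_mul_atTop (sub_pos.2 ha1))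
  filter_upwards [hy.eventually (lt_mem_nhds ha2), eventually_gt_atTop 0,
    hexp.eventually_ge_atTop R] with n hn hn0 hR
  simp only [Set.mem_empty_iff_false, iff_false, not_lt]
  rw [lt_div_iff₀ (Nat.cast_pos.2 hn0)] at hn
  calc R * Real.exp (a * n) ≤ Real.exp ((a' - a) * n) * Real.exp (a * n) := by gcongr
    _ = Real.exp (a' * n) := by rw [← Real.exp_add]; ring_nf
    _ ≤ Real.exp (∑ l ∈ Finset.range n, Real.log (y l)) := by
        rw [Real.exp_le_exp]
        exact hn.le.trans (Finset.sum_le_sum fun l _ => min_le_left _ _)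
    _ = ∏ l ∈ Finset.range n, y l := by
        rw [Real.exp_sum]
        exact Finset.prod_congr rfl fun l _ => Real.exp_log (hpos l)

lemma lintegral_indicator_density_lt (hX : IsIndependentCascade P X P' V) (n : ℕ)
    (x : SymbolicSpace b) (c : ℝ) :
    ∫⁻ ω, {ω | density X n ω x < c}.indicator (fun ω => ENNReal.ofReal (density X n ω x)) ω ∂P =
      spineLaw P' V x {y | ∏ l ∈ Finset.range n, y l < c} := by
  have hS : MeasurableSet {z : Fin n → ℝ | ∏ l, z l < c} :=
    measurableSet_lt (Finset.measurable_prod _ fun l _ => measurable_pi_apply l) measurable_const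
  have h := hX.lintegral_density_mul n x (measurable_one.indicator hS)
  have hr : Measurable fun (y : ℕ → ℝ) (l : Fin n) => y l :=
    measurable_pi_iff.2 fun l => measurable_pi_apply _
  rw [← lintegral_map (measurable_one.indicator hS) hr, lintegral_indicator_one hS,
    Measure.map_apply hr hS] at h
  have h2 : (fun (y : ℕ → ℝ) (l : Fin n) => y l) ⁻¹' {z | ∏ l, z l < c} =
      {y | ∏ l ∈ Finset.range n, y l < c} := by
    ext y
    simp only [Set.mem_preimage, Set.mem_ofPred_eq, Fin.prod_univ_eq_prod_range]
  rw [h2] at h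
  rw [← h]
  refine lintegral_congr fun ω => ?_
  have h3 : (fun l : Fin n => X (pre x (l + 1)) ω) ∈ {z : Fin n → ℝ | ∏ l, z l < c} ↔
      ω ∈ {ω | density X n ω x < c} := by
    simp only [Set.mem_ofPred_eq, density,
      Fin.prod_univ_eq_prod_range (fun l => X (pre x (l + 1)) ω)]
  by_cases hω : ω ∈ {ω | density X n ω x < c}
  · rw [Set.indicator_of_mem hω, Set.indicator_of_mem (h3.2 hω), Pi.one_apply, mul_one]
  · rw [Set.indicator_of_notMem hω, Set.indicator_of_notMem (mt h3.1 hω), mul_zero]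

variable (ν : Measure (SymbolicSpace b)) [IsProbabilityMeasure ν]

/-- The left side is the tilted probability that `Z_n < R`. Since `Z_n ≥ Q_n(x) ν [x|n]`, this event
forces either the cylinder around the spine to be smaller than `exp (-a n)` or the spine product to
be below `R exp (a n)`. -/
lemma lintegral_indicator_cylMass_le [IsProbabilityMeasure P] (hX : IsIndependentCascade P X P' V)
    (n : ℕ) (R a : ℝ) :
    ∫⁻ ω, {ω | cylMass ν X [] n ω < ENNReal.ofReal R}.indicator (cylMass ν X [] n) ω ∂P ≤
      ν {x | ν.real (cyl (pre x n)) < Real.exp (-(a * n))} +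
        ∫⁻ x, spineLaw P' V x {y | ∏ l ∈ Finset.range n, y l < R * Real.exp (a * n)} ∂ν := by
  have hmd : Measurable fun p : Ω × SymbolicSpace b => ENNReal.ofReal (density X n p.1 p.2) :=
    (measurable_density_uncurry fun v j _ => hX.measurable_X v j).ennreal_ofReal
  have hmZ : Measurable (cylMass ν X [] n) :=
    measurable_cylMass ν (fun v j _ => hX.measurable_X v j) []
  set A : Set Ω := {ω | cylMass ν X [] n ω < ENNReal.ofReal R}
  have hA : MeasurableSet A := measurableSet_lt hmZ measurable_const
  set T : Set (SymbolicSpace b) := {x | ν.real (cyl (pre x n)) < Real.exp (-(a * n))}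
  have hT : MeasurableSet T :=
    measurableSet_lt (measurable_comp_pre n fun u => ν.real (cyl u)) measurable_const
  rw [lintegral_indicator hA, hX.setLIntegral_cylMass ν, cyl_nil, setLIntegral_univ,
    ← lintegral_indicator_one hT, ← lintegral_add_left (measurable_one.indicator hT)]
  refine lintegral_mono fun x => ?_
  by_cases hx : x ∈ T
  · simp only [Set.indicator_of_mem hx, Pi.one_apply]
    refine le_add_right ?_
    exact (setLIntegral_le_lintegral _ _).trans (hX.lintegral_density n x).le
  · simp only [Set.indicator_of_notMem hx, zero_add]
    rw [← hX.lintegral_indicator_density_lt, ← lintegral_indicator hA]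
    refine lintegral_mono fun ω => ?_
    by_cases hω : ω ∈ A
    · have h1 : Real.exp (-(a * n)) ≤ ν.real (cyl (pre x n)) := not_lt.1 hx
      have h2 : density X n ω x * Real.exp (-(a * n)) < R := by
        have h3 : ENNReal.ofReal (density X n ω x * Real.exp (-(a * n))) < ENNReal.ofReal R := by
          refine lt_of_le_of_lt ?_ hω
          refine le_trans ?_ (density_mul_cyl_le X ν n ω x)
          rw [ENNReal.ofReal_mul (hX.density_nonneg n ω x), ← ofReal_measureReal]
          gcongr
        exact (ENNReal.ofReal_lt_ofReal_iff_of_nonneg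
          (mul_nonneg (hX.density_nonneg n ω x) (Real.exp_pos _).le)).1 h3
      have h4 : ω ∈ {ω | density X n ω x < R * Real.exp (a * n)} := by
        rw [Real.exp_neg, ← div_eq_mul_inv, div_lt_iff₀ (Real.exp_pos _)] at h2
        exact h2
      rw [Set.indicator_of_mem hω, Set.indicator_of_mem h4]
    · rw [Set.indicator_of_notMem hω]
      exact zero_le

/-- A rate `a` strictly between the two entropies makes both terms of
`lintegral_indicator_cylMass_le` vanish: the first by Shannon–McMillan, the second by the strong law
along the spine. -/
theorem lintegral_limitMass_eq_zero [IsProbabilityMeasure P] [IsProbabilityMeasure P']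
    (hX : IsIndependentCascade P X P' V) (hν : Ergodic shift ν)
    (h : entropy ν < weightEntropy P' V ν) : ∫⁻ ω, limitMass X ν ω ∂P = 0 := by
  rw [entropy_eq hν.toMeasurePreserving] at h
  obtain ⟨a, ha1, ha2⟩ := EReal.lt_iff_exists_real_btwn.1 h
  obtain ⟨K, hK⟩ := hX.exists_lt_of_lt_weightEntropy ha2
  have hprob : ∀ x, IsProbabilityMeasure (spineLaw P' V x) := fun x => by
    have := hX.isProbabilityMeasure_sizeBias
    unfold spineLaw; infer_instance
  have hmZ : ∀ n, Measurable (cylMass ν X [] n) := fun n =>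
    measurable_cylMass ν (fun v j _ => hX.measurable_X v j) []
  have hspine : ∀ R : ℝ, Tendsto (fun n : ℕ => ∫⁻ x, spineLaw P' V x
      {y | ∏ l ∈ Finset.range n, y l < R * Real.exp (a * n)} ∂ν) atTop (𝓝 0) := by
    intro R
    rw [← lintegral_zero (α := SymbolicSpace b) (μ := ν)]
    refine tendsto_lintegral_of_dominated_convergence (fun _ => 1) (fun n => ?_)
      (fun n => ae_of_all _ fun x => prob_le_one) (by simp) ?_
    · simp_rw [← hX.lintegral_indicator_density_lt]
      have hd : Measurable fun p : SymbolicSpace b × Ω => density X n p.2 p.1 :=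
        (measurable_density_uncurry fun v j _ => hX.measurable_X v j).comp measurable_swap
      exact Measurable.lintegral_prod_right' (f := fun p : SymbolicSpace b × Ω =>
        {p : SymbolicSpace b × Ω | density X n p.2 p.1 < R * Real.exp (a * n)}.indicator
          (fun p => ENNReal.ofReal (density X n p.2 p.1)) p)
        (hd.ennreal_ofReal.indicator (measurableSet_lt hd measurable_const))
    · filter_upwards [ae_hasLetterFreq hν] with x hx
      exact hX.tendsto_spineLaw_prod_lt hx hK R
  have hR : ∀ R : ℕ, ∀ᵐ ω ∂P, liminf (fun n => {ω | cylMass ν X [] n ω < ENNReal.ofReal R}.indicator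
      (cylMass ν X [] n) ω) atTop = 0 := by
    intro R
    have hmi : ∀ n, Measurable ({ω | cylMass ν X [] n ω < ENNReal.ofReal R}.indicator
        (cylMass ν X [] n)) := fun n =>
      (hmZ n).indicator (measurableSet_lt (hmZ n) measurable_const)
    have hlim := (tendsto_measure_cyl_lt hν (EReal.coe_lt_coe_iff.1 ha1)).add (hspine R)
    rw [add_zero] at hlim
    have hlim' := tendsto_of_tendsto_of_tendsto_of_le_of_le tendsto_const_nhds hlim
      (fun _ => zero_le) fun n => hX.lintegral_indicator_cylMass_le ν n R a
    have h0 := lintegral_liminf_le (μ := P) (u := atTop) hmi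
    rw [hlim'.liminf_eq, nonpos_iff_eq_zero, lintegral_eq_zero_iff (Measurable.liminf hmi)] at h0
    exact h0
  rw [lintegral_eq_zero_iff (hX.measurable_limitMass ν)]
  filter_upwards [ae_all_iff.2 hR, hX.ae_tendsto_limitMass ν] with ω h0 ⟨hfin, hlim⟩
  -- With an integer `R` above the finite limit, the cutoff is eventually inactive, so the limit of
  -- `Z_n` equals the lower limit of the cut-off masses, which is zero.
  obtain ⟨R, hRlt⟩ := ENNReal.exists_nat_gt hfin
  rw [Pi.zero_apply, ← h0 R]
  refine (Tendsto.liminf_eq (hlim.congr' ?_)).symm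
  filter_upwards [hlim.eventually (gt_mem_nhds hRlt)] with n hn
  have hn' : ω ∈ {ω | cylMass ν X [] n ω < ENNReal.ofReal R} := by
    simpa using hn
  exact (Set.indicator_of_mem hn' _).symm

end IsIndependentCascade

end Cascade

end

/-! ### The dichotomy -/

theorem corollary2p10 {b : ℕ} (hb : 2 ≤ b)
    {Ω : Type*} [MeasurableSpace Ω] (P : Measure Ω) [IsProbabilityMeasure P]
    {Ω' : Type*} [MeasurableSpace Ω'] (P' : Measure Ω') [IsProbabilityMeasure P']
    (X : List (Fin b) → Ω → ℝ) (V : Ω' → Fin b → ℝ)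
    (hX : Cascade.IsIndependentCascade P X P' V)
    (ν : Measure (Cascade.SymbolicSpace b)) [IsProbabilityMeasure ν]
    (hν : Ergodic Cascade.shift ν) :
    (Cascade.weightEntropy P' V ν < Cascade.entropy ν →
      ∫⁻ ω, Cascade.limitMass X ν ω ∂P = 1 ∧ Cascade.IsQRegular P X ν) ∧
    (Cascade.entropy ν < Cascade.weightEntropy P' V ν →
      ∫⁻ ω, Cascade.limitMass X ν ω ∂P = 0 ∧ Cascade.IsQSingular P X ν) := by
  refine ⟨fun h => ?_, fun h => ?_⟩
  · have h1 := hX.lintegral_limitMass_eq_one ν hν h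
    exact ⟨h1, hX.isQRegular ν (by rw [h1, measure_univ])⟩
  · have h0 := hX.lintegral_limitMass_eq_zero ν hν h
    exact ⟨h0, hX.isQSingular ν h0⟩
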